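/- Let $\mathcal A$ be a non-degenerate complete Boolean algebra, and let $p(a)$ denote the pairwise disjoint families $(a_i)$ in $\mathcal A$ with $\bigvee a_i=a$ (zero members allowed). **Conditional sets.** A *conditional set* $X$ on $\mathcal A$ is a family of sets $(X_a)_{a\in\mathcal A}$ with surjections $\gamma_a:X_1\to X_a$ such that $X_0$ is a singleton; $\gamma_1=\mathrm{id}$; $\gamma_b(x)=\gamma_b(y)$ implies $\gamma_a(x)=\gamma_a(y)$ for $a\le b$; and for all $(a_i)\in p(1)$ and $x_i\in X_{a_i}$ there is a unique $x\in X_1$ with $\gamma_{a_i}(x)=x_i$ for all $i$ (written $x=\sum a_ix_i$). For $a\le b$ write $x\mapsto ax$ for the induced map $X_b\to X_a$. "$x\in X$" means $x\in X_1$. Products are formed componentwise. A *conditional function* $f:X\to Y$ (or *conditional family* in $Y$ indexed by $X$) is a family of functions $f_a:X_a\to Y_a$ with $f_a(ax)=af_1(x)$ for $x\in X_1$. **Conditional subsets.** A *conditional subset* $Y\sqsubseteq X$ living on $b\in\mathcal A$ is given by a non-empty $Y_b\subseteq X_b$ closed under $\sum a_i(a_ix_i)$ for $(a_i)\in p(b)$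 and $x_i\in Y_b$; put $Y_a=\{ax:x\in Y_b\}$ for $a\le b$. Order conditional subsets by inclusion of all $Y_a$; they form a complete Boolean algebra with joins $\sqcup$, meets $\sqcap$, least element $\mathbf 0$ and greatest element $X$. The *conditional power set* $P(X)$ is the conditional set with $P(X)_a=\{Y\sqsubseteq X: Y\text{ lives on some }b\le a\}$ and $\gamma_a(Y)=aY$, the restriction of $Y$ to the condition $a$. **Conditional numbers.** For a non-empty set $E$ the *generated* conditional set $\mathbf E$ has as elements of $\mathbf E_a$ the formal sums $\sum a_ix_i$ with $(a_i)\in p(a)$ and $x_i\in E$, two sums being identified if $\bigvee\{a_i:x_i=z\}$ is the same for each $z\in E$. Let $\mathbf N,\mathbf Q$ be generated by $\mathbb N=\{1,2,\dots\}$ and $\mathbb Q$, with the induced operations and orders. The conditional reals $\mathbf R$ are the conditional quotient of the conditional Cauchy sequences $\mathbf N\to\mathbf Q$ by the relation "the difference converges conditionally to $0$", with addition induced pointwise and with $[(p_n)]\le[(q_n)]$ iff for all $\varepsilon\in\mathbf Q_{++}$ there is $n_0\in\mathbf N$ with $q_n-p_n>-\varepsilon$ for all $n\ge n_0$. Write $x<y$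 if $x\le y$ and $ax=ay$ only for $a=0$, and $\mathbf R_{++}=\{x\in\mathbf R:x>0\}$. A *conditionally finite family* is a conditional family indexed by $\{k\in\mathbf N: 1\le k\le n\}$ for some $n\in\mathbf N$; a *conditional sequence* is one indexed by $\mathbf N$. **Conditional metric spaces.** A *conditional metric* on $X$ is a conditional function $d:X\times X\to\mathbf R$ with $d(x,y)\ge0$; $d(x,y)=0$ iff $x=y$; $d(x,y)=d(y,x)$; and $d(x,z)\le d(x,y)+d(y,z)$. A *conditional topology* is a conditional subset of $P(X)$ living on $1$ that contains $\mathbf 0$ and $X$ and is closed under finite $\sqcap$ and arbitrary $\sqcup$; $X$ carries the one generated by the balls $B_\varepsilon(x)=\{y:d(x,y)<\varepsilon\}$, $x\in X$, $\varepsilon\in\mathbf R_{++}$. A *neighborhood* of $x\in X$ is a $U\sqsubseteq X$ such that $x\in O\sqsubseteq U$ for some conditionally open $O$. **Theorem.** Let $(X,d)$ be a conditional metric space. The following are equivalent: 1. $(X,d)$ is *conditionally compact*: for every conditional set $J$ and every conditional family $(O^j)_{j\in J}$ of conditionally open sets with $X=\sqcup_j O^j$ there are $n\in\mathbf N$ and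 a conditional family $(j_k)_{1\le k\le n}$ in $J$ with $X=\sqcup_{1\le k\le n}O^{j_k}$. 2. $(X,d)$ is *conditionally complete* (every conditional sequence $(x_n)$ such that for each $\varepsilon\in\mathbf R_{++}$ there is $n_0\in\mathbf N$ with $d(x_n,x_m)\le\varepsilon$ for all $n,m\ge n_0$ has a limit point $x\in X$, that is, for each neighborhood $U$ of $x$ there is $n_0\in\mathbf N$ with $x_n\in U$ for all $n\ge n_0$) and *conditionally totally bounded* (for each $\varepsilon\in\mathbf R_{++}$ there is a conditionally finite family $(x_k)_{1\le k\le n}$ in $X$ with $X=\sqcup_kB_\varepsilon(x_k)$). 3. $(X,d)$ is *conditionally sequentially compact*: every conditional sequence $(x_n)$ has a cluster point $x\in X$, that is, for each neighborhood $U$ of $x$ and each $n\in\mathbf N$ there is $m\ge n$ in $\mathbf N$ with $x_m\in U$. -/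

import Mathlib

universe u v w

namespace Conditional

/-- `(pᵢ) ∈ p(a)`: a pairwise disjoint family with supremum `a` (zero members are allowed). -/
def IsPart {A : Type u} [CompleteBooleanAlgebra A] {ι : Type w} (p : ι → A) (a : A) : Prop :=
  (⨆ i, p i) = a ∧ ∀ i j, i ≠ j → p i ⊓ p j = ⊥

section Basics

variable {A : Type u} [CompleteBooleanAlgebra A]

theorem IsPart.le {ι : Type w} {p : ι → A} {a : A} (hp : IsPart p a) (i : ι) : p i ≤ a :=
  hp.1 ▸ le_iSup p i

theorem IsPart.inf {ι : Type w} {p : ι → A} {a : A} (hp : IsPart p a) (b : A) :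
    IsPart (fun i => b ⊓ p i) (b ⊓ a) := by
  refine ⟨by rw [← inf_iSup_eq, hp.1], fun i j hij => ?_⟩
  rw [eq_bot_iff, ← hp.2 i j hij]
  exact inf_le_inf inf_le_right inf_le_right

theorem IsPart.inf_of_le {ι : Type w} {p : ι → A} {a b : A} (hp : IsPart p a) (h : b ≤ a) :
    IsPart (fun i => b ⊓ p i) b := by
  have := hp.inf b
  rwa [inf_eq_left.2 h] at this

theorem isPart_compl (a : A) : IsPart (fun b : ULift.{u} Bool => cond b.down a aᶜ) ⊤ := by
  refine ⟨?_, ?_⟩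
  · rw [eq_top_iff, ← sup_compl_eq_top (x := a)]
    exact sup_le (le_iSup (fun b : ULift.{u} Bool => cond b.down a aᶜ) ⟨true⟩)
      (le_iSup (fun b : ULift.{u} Bool => cond b.down a aᶜ) ⟨false⟩)
  · rintro ⟨i⟩ ⟨j⟩ h
    cases i <;> cases j <;> simp_all

/-- Every family `(aᵢ)` is refined by some `(bᵢ) ∈ p(⨆ aᵢ)` with `bᵢ ≤ aᵢ`. -/
theorem exists_isPart_le {ι : Type w} (p : ι → A) :
    ∃ q : ι → A, IsPart q (⨆ i, p i) ∧ ∀ i, q i ≤ p i := by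
  classical
  let r : ι → ι → Prop := WellOrderingRel
  have wf : WellFounded r := WellOrderingRel.isWellOrder.toIsWellFounded.wf
  refine ⟨fun i => p i ⊓ (⨆ j, ⨆ _ : r j i, p j)ᶜ, ⟨le_antisymm ?_ ?_, ?_⟩, fun i => inf_le_left⟩
  · exact iSup_mono fun i => inf_le_left
  · refine iSup_le fun i => ?_
    induction i using wf.induction with
    | _ i ih =>
      have h1 : (⨆ j, ⨆ _ : r j i, p j) ≤ ⨆ i, p i ⊓ (⨆ j, ⨆ _ : r j i, p j)ᶜ :=
        iSup_le fun j => iSup_le fun hj => ih j hj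
      calc p i = (p i ⊓ (⨆ j, ⨆ _ : r j i, p j)) ⊔ (p i ⊓ (⨆ j, ⨆ _ : r j i, p j)ᶜ) := by
            rw [← inf_sup_left, sup_compl_eq_top, inf_top_eq]
        _ ≤ _ := sup_le (inf_le_right.trans h1)
            (le_iSup (fun i => p i ⊓ (⨆ j, ⨆ _ : r j i, p j)ᶜ) i)
  · have key : ∀ i j, r i j → (p i ⊓ (⨆ k, ⨆ _ : r k i, p k)ᶜ) ⊓
        (p j ⊓ (⨆ k, ⨆ _ : r k j, p k)ᶜ) = ⊥ := by
      intro i j hij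
      have : p i ≤ ⨆ k, ⨆ _ : r k j, p k := le_iSup₂_of_le i hij le_rfl
      rw [eq_bot_iff, ← inf_compl_eq_bot (a := ⨆ k, ⨆ _ : r k j, p k)]
      exact inf_le_inf (inf_le_left.trans this) inf_le_right
    intro i j hij
    rcases trichotomous_of r i j with h | h | h
    · exact key i j h
    · exact absurd h hij
    · rw [inf_comm]; exact key j i h

end Basics


/-- A conditional set on `A`: a family of sets `X a` with maps `γ a : X ⊤ → X a`. The index type
of the partition in `stability` may be taken in the universe of `A`, since members equal to `⊥`
carry no information and the other members of a disjoint family are distinct. -/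
structure CondSet (A : Type u) [CompleteBooleanAlgebra A] where
  carrier : A → Type v
  γ : ∀ a, carrier ⊤ → carrier a
  bot_singleton : ∃ x : carrier ⊥, ∀ y, y = x
  surjective : ∀ a, Function.Surjective (γ a)
  identity : ∀ x, γ ⊤ x = x
  consistency : ∀ {a b : A}, a ≤ b → ∀ x y, γ b x = γ b y → γ a x = γ a y
  stability : ∀ {ι : Type u} (p : ι → A), IsPart p ⊤ → ∀ x : ∀ i, carrier (p i),
    ∃! y, ∀ i, γ (p i) y = x i

variable {A : Type u} [CompleteBooleanAlgebra A]

instance : CoeFun (CondSet.{u, v} A) (fun _ => A → Type v) := ⟨CondSet.carrier⟩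

namespace CondSet

/-- The induced map `γᵇₐ : X b → X a` for `a ≤ b`, written `x ↦ a x` in the literature. -/
noncomputable def res (X : CondSet.{u, v} A) {a b : A} (_h : a ≤ b) (x : X b) : X a :=
  X.γ a (Function.surjInv (X.surjective b) x)

variable (X : CondSet.{u, v} A)

theorem res_γ {a b : A} (h : a ≤ b) (x : X ⊤) : X.res h (X.γ b x) = X.γ a x :=
  X.consistency h _ _ (Function.surjInv_eq (X.surjective b) _)

theorem res_self {a : A} (h : a ≤ a) (x : X a) : X.res h x = x := by
  obtain ⟨x, rfl⟩ := X.surjective a x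
  exact X.res_γ h x

theorem res_res {a b c : A} (h : a ≤ b) (h' : b ≤ c) (x : X c) :
    X.res h (X.res h' x) = X.res (h.trans h') x := by
  obtain ⟨x, rfl⟩ := X.surjective c x
  rw [res_γ, res_γ, res_γ]

theorem res_top {a : A} (h : a ≤ ⊤) (x : X ⊤) : X.res h x = X.γ a x := by
  rw [← X.res_γ h x, X.identity]

theorem bot_eq (x y : X ⊥) : x = y := by
  obtain ⟨z, hz⟩ := X.bot_singleton
  rw [hz x, hz y]

theorem exists_pair (a : A) (x : X a) (y : X aᶜ) : ∃ z : X ⊤, X.γ a z = x ∧ X.γ aᶜ z = y := by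
  obtain ⟨z, hz, -⟩ := X.stability _ (isPart_compl a)
    (fun i => match i with | ⟨true⟩ => x | ⟨false⟩ => y)
  exact ⟨z, hz ⟨true⟩, hz ⟨false⟩⟩

/-- Two elements of `X ⊤` that agree on each member of a cover of `a` agree on `a`. -/
theorem ext_cover_top {ι : Type u} {p : ι → A} {a : A} (hp : (⨆ i, p i) = a) (x y : X ⊤)
    (h : ∀ i, X.γ (p i) x = X.γ (p i) y) : X.γ a x = X.γ a y := by
  obtain ⟨q, hq, hqp⟩ := exists_isPart_le (fun o : Option ι => o.elim aᶜ p)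
  have htop : (⨆ o : Option ι, o.elim aᶜ p) = ⊤ := by
    rw [iSup_option]; simp [hp]
  rw [htop] at hq
  obtain ⟨z, hz, hz'⟩ := X.exists_pair a (X.γ a x) (X.γ aᶜ y)
  have e : z = y := by
    refine (X.stability q hq (fun o => X.γ (q o) y)).unique ?_ (fun _ => rfl)
    rintro (_ | i)
    · exact X.consistency (hqp none) z y hz'
    · have hle : p i ≤ a := hp ▸ le_iSup p i
      exact X.consistency (hqp (some i)) z y
        ((X.consistency hle z x hz).trans (h i))
  rw [← hz, e]

theorem ext_cover {ι : Type u} {p : ι → A} {a : A} (hp : (⨆ i, p i) = a) (hle : ∀ i, p i ≤ a)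
    (x y : X a) (h : ∀ i, X.res (hle i) x = X.res (hle i) y) : x = y := by
  obtain ⟨x, rfl⟩ := X.surjective a x
  obtain ⟨y, rfl⟩ := X.surjective a y
  refine X.ext_cover_top hp x y fun i => ?_
  simpa only [res_γ] using h i

/-- Amalgamation over an element of `p(a)`. -/
theorem exists_glue {ι : Type u} {p : ι → A} {a : A} (hp : IsPart p a) (x : ∀ i, X (p i)) :
    ∃! y : X a, ∀ i, X.res (hp.le i) y = x i := by
  obtain ⟨w⟩ : Nonempty (X aᶜ) := ⟨X.γ _ (Function.surjInv (X.surjective ⊥) X.bot_singleton.choose)⟩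
  have hq : IsPart (fun o : Option ι => o.elim aᶜ p) ⊤ := by
    refine ⟨by rw [iSup_option]; simp [hp.1], ?_⟩
    have h0 : ∀ i, p i ⊓ aᶜ = ⊥ := fun i =>
      eq_bot_iff.2 ((inf_le_inf_right _ (hp.le i)).trans inf_compl_eq_bot.le)
    rintro (_ | i) (_ | j) hij
    · exact absurd rfl hij
    · show aᶜ ⊓ p j = ⊥
      rw [inf_comm]; exact h0 j
    · exact h0 i
    · exact hp.2 i j fun e => hij (congrArg some e)
  obtain ⟨z, hz, -⟩ := X.stability _ hq (fun o => match o with | none => w | some i => x i)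
  refine ⟨X.γ a z, fun i => ?_, fun y hy => ?_⟩
  · rw [res_γ]; exact hz (some i)
  · refine X.ext_cover hp.1 hp.le _ _ fun i => ?_
    rw [hy i, res_γ]; exact (hz (some i)).symm

/-- The conditional product of two conditional sets. -/
def prod (X : CondSet.{u, v} A) (Y : CondSet.{u, w} A) : CondSet.{u, max v w} A where
  carrier a := X a × Y a
  γ a z := (X.γ a z.1, Y.γ a z.2)
  bot_singleton := by
    obtain ⟨x, hx⟩ := X.bot_singleton
    obtain ⟨y, hy⟩ := Y.bot_singleton
    exact ⟨(x, y), fun z => Prod.ext (hx _) (hy _)⟩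
  surjective a z := by
    obtain ⟨x, hx⟩ := X.surjective a z.1
    obtain ⟨y, hy⟩ := Y.surjective a z.2
    exact ⟨(x, y), Prod.ext hx hy⟩
  identity z := Prod.ext (X.identity _) (Y.identity _)
  consistency h x y e := Prod.ext (X.consistency h _ _ (congrArg Prod.fst e))
    (Y.consistency h _ _ (congrArg Prod.snd e))
  stability p hp z := by
    obtain ⟨x, hx, hx'⟩ := X.stability p hp (fun i => (z i).1)
    obtain ⟨y, hy, hy'⟩ := Y.stability p hp (fun i => (z i).2)
    exact ⟨(x, y), fun i => Prod.ext (hx i) (hy i), fun t ht =>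
      Prod.ext (hx' _ fun i => congrArg Prod.fst (ht i))
        (hy' _ fun i => congrArg Prod.snd (ht i))⟩

end CondSet

/-- A conditional function `f : X → Y`, as a family of functions `f a : X a → Y a` whose graphs
form a conditional subset of `X × Y`; this means that the family commutes with the maps `γ`
(equivalently, `f (∑ aᵢ xᵢ) = ∑ aᵢ f (xᵢ)`). -/
structure CondFun (X : CondSet.{u, v} A) (Y : CondSet.{u, w} A) where
  app : ∀ a, X a → Y a
  natural : ∀ a (x : X ⊤), app a (X.γ a x) = Y.γ a (app ⊤ x)

/-- A conditional function is determined by, and can be built from, its action on primal sets. -/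
noncomputable def CondFun.ofTop {X : CondSet.{u, v} A} {Y : CondSet.{u, w} A} (f : X ⊤ → Y ⊤)
    (hf : ∀ a x y, X.γ a x = X.γ a y → Y.γ a (f x) = Y.γ a (f y)) : CondFun X Y where
  app a x := Y.γ a (f (Function.surjInv (X.surjective a) x))
  natural a x := by
    have e : Function.surjInv (X.surjective ⊤) x = x :=
      (X.identity _).symm.trans (Function.surjInv_eq (X.surjective ⊤) x)
    rw [Y.identity, e]
    exact hf a _ _ (Function.surjInv_eq (X.surjective a) _)

theorem CondFun.ofTop_app_top {X : CondSet.{u, v} A} {Y : CondSet.{u, w} A} (f : X ⊤ → Y ⊤)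
    (hf : ∀ a x y, X.γ a x = X.γ a y → Y.γ a (f x) = Y.γ a (f y)) (x : X ⊤) :
    (CondFun.ofTop f hf).app ⊤ x = f x := by
  have e : Function.surjInv (X.surjective ⊤) x = x :=
    (X.identity _).symm.trans (Function.surjInv_eq (X.surjective ⊤) x)
  show Y.γ ⊤ (f (Function.surjInv (X.surjective ⊤) x)) = f x
  rw [Y.identity, e]

/-! ### Conditional subsets and the conditional power set -/

/-- A conditional subset `Y` of `X`, given by the family of the sets `Y_a ⊆ X_a`, where `Y_a` is
read as empty when `a` is not below the condition `b` on which `Y` lives. The family is closed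
under restriction and amalgamation; `exists_lives_on` recovers `b` and shows that `Y_a` is the
image of the stable set `Y_b` for `a ≤ b`, and `exists_unique_of_stable` shows that conditional
subsets living on `b` correspond to the non-empty stable subsets of `X_b`. -/
@[ext] structure CondSubset (X : CondSet.{u, v} A) where
  sec : ∀ a, Set (X a)
  res_mem : ∀ {a b : A} (h : a ≤ b) {x : X b}, x ∈ sec b → X.res h x ∈ sec a
  glue_mem : ∀ {a : A} {ι : Type u} (p : ι → A) (hp : IsPart p a) (x : X a),
    (∀ i, X.res (hp.le i) x ∈ sec (p i)) → x ∈ sec a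

namespace CondSubset

variable {X : CondSet.{u, v} A}

theorem mem_bot (Y : CondSubset X) (x : X ⊥) : x ∈ Y.sec ⊥ :=
  Y.glue_mem (ι := PEmpty) (fun i => i.elim) ⟨iSup_of_empty _, fun i => i.elim⟩ x fun i => i.elim

/-- `Y` lives on the condition `b`. -/
def LivesOn (Y : CondSubset X) (b : A) : Prop := ∀ a, (Y.sec a).Nonempty ↔ a ≤ b

theorem exists_lives_on (Y : CondSubset X) :
    ∃ b, Y.LivesOn b ∧ ∀ a (h : a ≤ b), Y.sec a = X.res h '' Y.sec b := by
  let ι := {a : A // (Y.sec a).Nonempty}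
  obtain ⟨q, hq, hqp⟩ := exists_isPart_le (fun i : ι => i.1)
  obtain ⟨y, hy, -⟩ := X.exists_glue hq (fun i => X.res (hqp i) i.2.some)
  have hyb : y ∈ Y.sec _ := Y.glue_mem q hq y fun i => by
    rw [hy i]; exact Y.res_mem _ i.2.some_mem
  refine ⟨_, fun a => ⟨fun h => le_iSup (fun i : ι => i.1) ⟨a, h⟩,
    fun h => ⟨_, Y.res_mem h hyb⟩⟩, fun a h => ?_⟩
  ext x
  refine ⟨fun hx => ?_, ?_⟩
  · obtain ⟨x, rfl⟩ := X.surjective a x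
    obtain ⟨y, rfl⟩ := X.surjective _ y
    obtain ⟨z, hz, hz'⟩ := X.exists_pair a (X.γ a x) (X.γ aᶜ y)
    refine ⟨X.γ _ z, Y.glue_mem _ ((isPart_compl a).inf_of_le le_top) _ ?_, ?_⟩
    · rintro ⟨_ | _⟩
      · have e := X.consistency (a := (⨆ i : ι, i.1) ⊓ aᶜ) inf_le_right z y hz'
        have := Y.res_mem (a := (⨆ i : ι, i.1) ⊓ aᶜ) inf_le_left hyb
        rw [X.res_γ, ← e] at this
        rw [X.res_γ]; exact this
      · have e := X.consistency (a := (⨆ i : ι, i.1) ⊓ a) inf_le_right z x hz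
        have := Y.res_mem (a := (⨆ i : ι, i.1) ⊓ a) inf_le_right hx
        rw [X.res_γ, ← e] at this
        rw [X.res_γ]; exact this
    · rw [X.res_γ, hz]
  · rintro ⟨z, hz, rfl⟩
    exact Y.res_mem h hz

theorem exists_unique_of_stable (b : A) (S : Set (X b)) (hne : S.Nonempty)
    (hS : ∀ {ι : Type u} (p : ι → A) (hp : IsPart p b) (x : ι → X b) (y : X b),
      (∀ i, x i ∈ S) → (∀ i, X.res (hp.le i) y = X.res (hp.le i) (x i)) → y ∈ S) :
    ∃! Y : CondSubset X, Y.LivesOn b ∧ Y.sec b = S := by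
  obtain ⟨s, hs⟩ := hne
  let Y : CondSubset X :=
    { sec := fun a => {x | ∃ h : a ≤ b, ∃ y ∈ S, X.res h y = x}
      res_mem := by
        rintro a c h x ⟨hc, y, hy, rfl⟩
        exact ⟨h.trans hc, y, hy, (X.res_res h hc y).symm⟩
      glue_mem := by
        intro a ι p hp x hx
        choose hb y hy hyx using hx
        have hab : a ≤ b := hp.1 ▸ iSup_le hb
        have hq : IsPart (fun o : Option ι => o.elim (b ⊓ aᶜ) p) b := by
          refine ⟨?_, ?_⟩
          · rw [iSup_option]
            show b ⊓ aᶜ ⊔ (⨆ i, p i) = b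
            rw [hp.1]
            refine le_antisymm (sup_le inf_le_left hab) ?_
            calc b = b ⊓ aᶜ ⊔ b ⊓ a := by rw [← inf_sup_left, compl_sup_eq_top, inf_top_eq]
              _ ≤ _ := sup_le_sup le_rfl inf_le_right
          · have h0 : ∀ i, p i ⊓ (b ⊓ aᶜ) = ⊥ := fun i =>
              eq_bot_iff.2 ((inf_le_inf (hp.le i) inf_le_right).trans inf_compl_eq_bot.le)
            rintro (_ | i) (_ | j) hij
            · exact absurd rfl hij
            · show (b ⊓ aᶜ) ⊓ p j = ⊥
              rw [inf_comm]; exact h0 j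
            · exact h0 i
            · exact hp.2 i j fun e => hij (congrArg some e)
        obtain ⟨z, hz, -⟩ := X.exists_glue hq (fun o => X.res (hq.le o)
          (match o with | none => s | some i => y i))
        refine ⟨hab, z, hS _ hq (fun o => match o with | none => s | some i => y i) z ?_ hz, ?_⟩
        · rintro (_ | i)
          · exact hs
          · exact hy i
        · refine X.ext_cover hp.1 hp.le _ _ fun i => ?_
          rw [X.res_res, ← hyx i]; exact hz (some i) }
  have hYb : Y.sec b = S := by
    ext x
    refine ⟨?_, fun hx => ⟨le_rfl, x, hx, X.res_self _ x⟩⟩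
    rintro ⟨h, y, hy, rfl⟩
    rwa [X.res_self]
  refine ⟨Y, ⟨fun a => ⟨?_, fun h => ⟨_, h, s, hs, rfl⟩⟩, hYb⟩, ?_⟩
  · rintro ⟨_, h, -⟩
    exact h
  · rintro Z ⟨hZ, hZb⟩
    ext a x
    obtain ⟨c, hc, hc'⟩ := Z.exists_lives_on
    obtain rfl : b = c := le_antisymm ((hc b).1 ((hZ b).2 le_rfl)) ((hZ c).1 ((hc c).2 le_rfl))
    constructor
    · intro hx
      have h := (hZ a).1 ⟨x, hx⟩
      rw [hc' a h, hZb] at hx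
      obtain ⟨y, hy, rfl⟩ := hx
      exact ⟨h, y, hy, rfl⟩
    · rintro ⟨h, y, hy, rfl⟩
      rw [← hZb] at hy
      exact Z.res_mem h hy

/-- The conditional inclusion `Y ⊑ Z`. -/
instance : PartialOrder (CondSubset X) where
  le Y Z := ∀ a, Y.sec a ⊆ Z.sec a
  le_refl _ _ := subset_rfl
  le_trans _ _ _ h h' a := (h a).trans (h' a)
  le_antisymm _ _ h h' := CondSubset.ext (funext fun a => (h a).antisymm (h' a))

/-- `X` as a conditional subset of itself. -/
def univ (X : CondSet.{u, v} A) : CondSubset X where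
  sec _ := Set.univ
  res_mem _ _ _ := trivial
  glue_mem _ _ _ _ := trivial

/-- The conditional empty set `𝟎`, which lives on `⊥`. -/
def empty (X : CondSet.{u, v} A) : CondSubset X where
  sec a := {_x | a = ⊥}
  res_mem h _ hb := le_bot_iff.1 (h.trans (le_of_eq hb))
  glue_mem {a} _ p hp x h := by
    show a = ⊥
    rw [← hp.1]
    exact iSup_eq_bot.2 h

/-- The conditional intersection `Y ⊓ Z`. -/
def inter (Y Z : CondSubset X) : CondSubset X where
  sec a := Y.sec a ∩ Z.sec a
  res_mem h _ hx := ⟨Y.res_mem h hx.1, Z.res_mem h hx.2⟩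
  glue_mem p hp x hx :=
    ⟨Y.glue_mem p hp x fun i => (hx i).1, Z.glue_mem p hp x fun i => (hx i).2⟩

theorem isGLB_inter (Y Z : CondSubset X) : IsGLB {Y, Z} (inter Y Z) := by
  constructor
  · rintro W (rfl | rfl) a
    · exact Set.inter_subset_left
    · exact Set.inter_subset_right
  · intro W hW a x hx
    exact ⟨hW (Or.inl rfl) a hx, hW (Or.inr rfl) a hx⟩

/-- The conditional union of the members of `S`: the elements that belong locally to members
of `S`. -/
def sUnion (S : Set (CondSubset X)) : CondSubset X where
  sec a := {x | sSup {b | ∃ h : b ≤ a, ∃ Y ∈ S, X.res h x ∈ Y.sec b} = a}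
  res_mem := by
    intro a b h x hx
    refine le_antisymm (sSup_le fun c hc => hc.1) ?_
    calc a = a ⊓ sSup {c | ∃ h : c ≤ b, ∃ Y ∈ S, X.res h x ∈ Y.sec c} := by
          rw [hx, inf_eq_left.2 h]
      _ ≤ _ := by
          rw [inf_sSup_eq]
          refine iSup₂_le fun c hc => le_sSup ?_
          obtain ⟨hcb, Y, hY, hx⟩ := hc
          refine ⟨inf_le_left, Y, hY, ?_⟩
          have := Y.res_mem (a := a ⊓ c) inf_le_right hx
          rwa [X.res_res] at this ⊢
  glue_mem := by
    intro a ι p hp x hx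
    refine le_antisymm (sSup_le fun c hc => hc.1) ?_
    conv_lhs => rw [← hp.1]
    refine iSup_le fun i => ?_
    rw [← hx i]
    refine sSup_le_sSup ?_
    rintro c ⟨hc, Y, hY, hx⟩
    exact ⟨hc.trans (hp.le i), Y, hY, by rwa [X.res_res] at hx⟩

theorem isLUB_sUnion (S : Set (CondSubset X)) : IsLUB S (sUnion S) := by
  constructor
  · intro Y hY a x hx
    refine le_antisymm (sSup_le fun c hc => hc.1) (le_sSup ⟨le_rfl, Y, hY, ?_⟩)
    rwa [X.res_self]
  · intro Z hZ a x hx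
    obtain ⟨q, hq, hqp⟩ := exists_isPart_le
      (fun b : {b | ∃ h : b ≤ a, ∃ Y ∈ S, X.res h x ∈ Y.sec b} => b.1)
    rw [← sSup_eq_iSup', hx] at hq
    refine Z.glue_mem q hq x fun i => ?_
    obtain ⟨h, Y, hY, hx⟩ := i.2
    have := Z.res_mem (hqp i) (hZ hY _ hx)
    rwa [X.res_res] at this

/-- The conditional subset `c Y`, the restriction of `Y` to the condition `c`. -/
def cut (Y : CondSubset X) (c : A) : CondSubset X where
  sec a := {x | x ∈ Y.sec a ∧ a ≤ c}
  res_mem h _ hx := ⟨Y.res_mem h hx.1, h.trans hx.2⟩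
  glue_mem p hp x hx :=
    ⟨Y.glue_mem p hp x fun i => (hx i).1, hp.1 ▸ iSup_le fun i => (hx i).2⟩

/-- A conditional subset living on `⊤`, as a conditional set. -/
def toCondSet (Y : CondSubset X) (hY : (Y.sec ⊤).Nonempty) : CondSet.{u, v} A where
  carrier a := Y.sec a
  γ a x := ⟨X.γ a x.1, by
    have := Y.res_mem (le_top : a ≤ ⊤) x.2
    rwa [X.res_top] at this⟩
  bot_singleton := by
    obtain ⟨x⟩ : Nonempty (Y.sec ⊥) := ⟨⟨_, Y.res_mem (bot_le : ⊥ ≤ ⊤) hY.some_mem⟩⟩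
    exact ⟨x, fun y => Subtype.ext (X.bot_eq _ _)⟩
  surjective a := by
    rintro ⟨x, hx⟩
    obtain ⟨z, hz, hz'⟩ := X.exists_pair a x (X.γ aᶜ hY.some)
    refine ⟨⟨z, Y.glue_mem _ (isPart_compl a) z ?_⟩, Subtype.ext hz⟩
    rintro ⟨_ | _⟩
    · show X.res _ z ∈ Y.sec aᶜ
      rw [X.res_top, hz', ← X.res_top le_top]
      exact Y.res_mem le_top hY.some_mem
    · show X.res _ z ∈ Y.sec a
      rw [X.res_top, hz]
      exact hx
  identity x := Subtype.ext (X.identity _)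
  consistency h x y e := Subtype.ext (X.consistency h _ _ (congrArg Subtype.val e))
  stability p hp x := by
    obtain ⟨y, hy, hy'⟩ := X.stability p hp (fun i => (x i).1)
    refine ⟨⟨y, Y.glue_mem p hp y fun i => ?_⟩, fun i => Subtype.ext (hy i), fun z hz =>
      Subtype.ext (hy' _ fun i => congrArg Subtype.val (hz i))⟩
    rw [X.res_top, hy]
    exact (x i).2

end CondSubset

namespace CondSet

/-- The conditional power set: `P(X) a` consists of the conditional subsets of `X` that live on a
condition below `a`, and `γ a` sends `Y` to `a Y`. -/
def powerset (X : CondSet.{u, v} A) : CondSet.{u, max u v} A where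
  carrier a := {Y : CondSubset X // ∀ c, (Y.sec c).Nonempty → c ≤ a}
  γ a Y := ⟨Y.1.cut a, fun _ h => h.some_mem.2⟩
  bot_singleton := by
    refine ⟨⟨CondSubset.empty X, fun c h => le_of_eq h.some_mem⟩, fun Y => Subtype.ext ?_⟩
    ext a x
    constructor
    · exact fun h => le_bot_iff.1 (Y.2 a ⟨x, h⟩)
    · intro h
      obtain rfl : a = ⊥ := h
      exact Y.1.mem_bot x
  surjective a Y := by
    refine ⟨⟨Y.1, fun _ _ => le_top⟩, Subtype.ext ?_⟩
    ext c x
    exact ⟨fun h => h.1, fun h => ⟨h, Y.2 c ⟨x, h⟩⟩⟩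
  identity Y := by
    refine Subtype.ext ?_
    ext c x
    exact ⟨fun h => h.1, fun h => ⟨h, le_top⟩⟩
  consistency {a b} hab Y Z e := by
    have key : ∀ c x, (x ∈ Y.1.sec c ∧ c ≤ b) ↔ (x ∈ Z.1.sec c ∧ c ≤ b) := fun c x => by
      have := congrArg (fun W : {Y : CondSubset X // ∀ c, (Y.sec c).Nonempty → c ≤ b} =>
        x ∈ W.1.sec c) e
      exact iff_of_eq this
    refine Subtype.ext ?_
    ext c x
    exact ⟨fun h => ⟨((key c x).1 ⟨h.1, h.2.trans hab⟩).1, h.2⟩,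
      fun h => ⟨((key c x).2 ⟨h.1, h.2.trans hab⟩).1, h.2⟩⟩
  stability {ι} p hp Y := by
    let Z : CondSubset X :=
      { sec := fun c => {x | ∀ i, X.res (inf_le_left : c ⊓ p i ≤ c) x ∈ (Y i).1.sec (c ⊓ p i)}
        res_mem := by
          intro a b h x hx i
          have := (Y i).1.res_mem (inf_le_inf_right (p i) h) (hx i)
          rwa [X.res_res] at this ⊢
        glue_mem := by
          intro a κ q hq x hx i
          have hr : IsPart (fun k => a ⊓ p i ⊓ q k) (a ⊓ p i) := hq.inf_of_le inf_le_left
          refine (Y i).1.glue_mem _ hr _ fun k => ?_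
          have h1 : a ⊓ p i ⊓ q k ≤ q k ⊓ p i := le_inf inf_le_right (inf_le_left.trans inf_le_right)
          have := (Y i).1.res_mem h1 (hx k i)
          rw [X.res_res, X.res_res] at this
          rwa [X.res_res] }
    have hcongr : ∀ (W : CondSubset X) {a b : A} (e : a = b) (x : X b),
        x ∈ W.sec b ↔ X.res (le_of_eq e) x ∈ W.sec a := by
      rintro W a _ rfl x
      rw [X.res_self]
    refine ⟨⟨Z, fun _ _ => le_top⟩, fun i => Subtype.ext ?_, fun W hW => Subtype.ext ?_⟩
    · ext c x
      constructor
      · rintro ⟨h, hc⟩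
        exact (hcongr _ (inf_eq_left.2 hc) x).2 (h i)
      · intro h
        have hc := (Y i).2 c ⟨x, h⟩
        refine ⟨fun j => ?_, hc⟩
        by_cases hij : i = j
        · subst hij
          exact (Y i).1.res_mem _ h
        · have h0 : c ⊓ p j = ⊥ := le_bot_iff.1 ((inf_le_inf_right _ hc).trans (hp.2 i j hij).le)
          have := (Y j).1.mem_bot (X.res bot_le x)
          rw [hcongr (Y j).1 h0] at this
          rwa [X.res_res] at this
    · have key : ∀ i c x, (x ∈ W.1.sec c ∧ c ≤ p i) ↔ x ∈ (Y i).1.sec c := fun i c x =>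
        iff_of_eq (congrArg (fun V : {Y : CondSubset X // ∀ c, (Y.sec c).Nonempty → c ≤ p i} =>
          x ∈ V.1.sec c) (hW i))
      ext c x
      constructor
      · exact fun h i => (key i _ _).1 ⟨W.1.res_mem _ h, inf_le_right⟩
      · exact fun h => W.1.glue_mem _ (hp.inf_of_le le_top) x fun i => ((key i _ _).2 (h i)).1

end CondSet

/-! ### Generated conditional sets, conditional natural and rational numbers -/

/-- The conditional set generated by `E`. A formal sum `∑ aᵢ xᵢ` with `(aᵢ) ∈ p(a)` and `xᵢ ∈ E`
is determined, up to the identification of such sums, by the function `z ↦ ⨆ {aᵢ | xᵢ = z}`;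
these functions are exactly the elements of `p(a)` indexed by `E`. -/
def gen (A : Type u) [CompleteBooleanAlgebra A] (E : Type) [Inhabited E] : CondSet.{u, u} A where
  carrier a := {f : E → A // IsPart f a}
  γ a f := ⟨fun z => a ⊓ f.1 z, f.2.inf_of_le le_top⟩
  bot_singleton := by
    refine ⟨⟨fun _ => ⊥, by simp [IsPart]⟩, fun f => Subtype.ext (funext fun z => ?_)⟩
    exact le_bot_iff.1 (f.2.le z)
  surjective a f := by
    classical
    have h0 : ∀ z, f.1 z ⊓ aᶜ = ⊥ := fun z =>
      eq_bot_iff.2 ((inf_le_inf_right _ (f.2.le z)).trans inf_compl_eq_bot.le)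
    refine ⟨⟨fun z => f.1 z ⊔ (if z = default then aᶜ else ⊥), ?_, ?_⟩, Subtype.ext ?_⟩
    · rw [iSup_sup_eq, f.2.1, iSup_ite]
      simp
    · intro y z h
      by_cases hy : y = default
      · have hz : z ≠ default := fun e => h (hy.trans e.symm)
        have := f.2.2 y z h
        simp only [hy, hz, if_true, if_false, sup_bot_eq, inf_sup_right] at this ⊢
        rw [this, inf_comm, h0, sup_bot_eq]
      · by_cases hz : z = default
        · have := f.2.2 y z h
          simp only [hy, hz, if_true, if_false, sup_bot_eq, inf_sup_left] at this ⊢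
          rw [this, h0, sup_bot_eq]
        · simpa [hy, hz] using f.2.2 y z h
    · funext z
      show a ⊓ (f.1 z ⊔ _) = f.1 z
      rw [inf_sup_left, inf_eq_right.2 (f.2.le z)]
      split_ifs <;> simp
  identity f := Subtype.ext (funext fun z => top_inf_eq _)
  consistency {a b} h f g e := by
    refine Subtype.ext (funext fun z => ?_)
    have := congrFun (congrArg Subtype.val e) z
    show a ⊓ f.1 z = a ⊓ g.1 z
    calc a ⊓ f.1 z = a ⊓ (b ⊓ f.1 z) := by rw [← inf_assoc, inf_eq_left.2 h]
      _ = a ⊓ (b ⊓ g.1 z) := congrArg (a ⊓ ·) this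
      _ = _ := by rw [← inf_assoc, inf_eq_left.2 h]
  stability {ι} p hp f := by
    have h0 : ∀ i j y z, i ≠ j → (f i).1 y ⊓ (f j).1 z = ⊥ := fun i j y z hij =>
      le_bot_iff.1 ((inf_le_inf ((f i).2.le y) ((f j).2.le z)).trans (hp.2 i j hij).le)
    refine ⟨⟨fun z => ⨆ i, (f i).1 z, ?_, ?_⟩, fun i => Subtype.ext (funext fun z => ?_),
      fun g hg => Subtype.ext (funext fun z => ?_)⟩
    · rw [iSup_comm, ← hp.1]
      exact iSup_congr fun i => (f i).2.1
    · intro y z h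
      rw [iSup_inf_eq, iSup_eq_bot]
      intro i
      rw [inf_iSup_eq, iSup_eq_bot]
      intro j
      by_cases hij : i = j
      · subst hij; exact (f i).2.2 y z h
      · exact h0 i j y z hij
    · show p i ⊓ (⨆ j, (f j).1 z) = (f i).1 z
      rw [inf_iSup_eq]
      refine le_antisymm (iSup_le fun j => ?_)
        (le_iSup_of_le i (le_inf ((f i).2.le z) le_rfl))
      by_cases hij : i = j
      · subst hij; exact inf_le_right
      · refine ((inf_le_inf_left _ ((f j).2.le z)).trans ?_).trans bot_le
        exact (hp.2 i j hij).le
    · show g.1 z = ⨆ i, (f i).1 z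
      calc g.1 z = (⨆ i, p i) ⊓ g.1 z := by rw [hp.1, top_inf_eq]
        _ = ⨆ i, p i ⊓ g.1 z := iSup_inf_eq ..
        _ = _ := iSup_congr fun i => congrFun (congrArg Subtype.val (hg i)) z

namespace Gen

variable {E F G : Type} [Inhabited E] [Inhabited F] [Inhabited G]

open Classical in
/-- The element of the generated conditional set given by `z : E`. -/
noncomputable def const (A : Type u) [CompleteBooleanAlgebra A] (z : E) : gen A E ⊤ :=
  ⟨fun y => if y = z then ⊤ else ⊥, by
    refine ⟨?_, fun i j h => ?_⟩
    · rw [iSup_ite]; simp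
    · by_cases hi : i = z
      · have hj : j ≠ z := fun e => h (hi.trans e.symm)
        simp [hj]
      · simp [hi]⟩

/-- The conditional relation generated by `R`. -/
def Rel (R : E → F → Prop) {a : A} (x : gen A E a) (y : gen A F a) : Prop :=
  ∀ r s, x.1 r ⊓ y.1 s ≠ ⊥ → R r s

/-- The conditional binary operation generated by `f`:
`f (∑ aᵢ xᵢ, ∑ bⱼ yⱼ) = ∑ (aᵢ ⊓ bⱼ) f (xᵢ, yⱼ)`. -/
def map₂ (f : E → F → G) {a : A} (x : gen A E a) (y : gen A F a) : gen A G a :=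
  ⟨fun z => ⨆ r, ⨆ s, ⨆ _ : f r s = z, x.1 r ⊓ y.1 s, by
    refine ⟨le_antisymm ?_ ?_, ?_⟩
    · exact iSup_le fun z => iSup_le fun r => iSup_le fun s => iSup_le fun _ =>
        inf_le_left.trans (x.2.le r)
    · calc a = (⨆ r, x.1 r) ⊓ (⨆ s, y.1 s) := by rw [x.2.1, y.2.1, inf_idem]
        _ ≤ _ := by
          rw [iSup_inf_eq]
          refine iSup_le fun r => ?_
          rw [inf_iSup_eq]
          exact iSup_le fun s => le_iSup_of_le (f r s) (le_iSup_of_le r (le_iSup_of_le s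
            (le_iSup_of_le rfl le_rfl)))
    · intro z z' h
      simp only [iSup_inf_eq, inf_iSup_eq, iSup_eq_bot]
      intro r s e r' s' e'
      by_cases hr : r = r'
      · by_cases hs : s = s'
        · subst hr; subst hs; exact absurd (e'.symm.trans e) h
        · exact le_bot_iff.1 ((inf_le_inf inf_le_right inf_le_right).trans (y.2.2 s' s (Ne.symm hs)).le)
      · exact le_bot_iff.1 ((inf_le_inf inf_le_left inf_le_left).trans (x.2.2 r' r (Ne.symm hr)).le)⟩

/-- The conditional function generated by `f`: `f (∑ aᵢ xᵢ) = ∑ aᵢ f (xᵢ)`. -/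
def map (f : E → G) {a : A} (x : gen A E a) : gen A G a :=
  ⟨fun z => ⨆ r, ⨆ _ : f r = z, x.1 r, by
    refine ⟨le_antisymm ?_ ?_, ?_⟩
    · exact iSup_le fun z => iSup_le fun r => iSup_le fun _ => x.2.le r
    · conv_lhs => rw [← x.2.1]
      exact iSup_le fun r => le_iSup_of_le (f r) (le_iSup_of_le r (le_iSup_of_le rfl le_rfl))
    · intro z z' h
      simp only [iSup_inf_eq, inf_iSup_eq, iSup_eq_bot]
      intro r e r' e'
      refine x.2.2 _ _ fun hr => h ?_
      subst hr
      exact e'.symm.trans e⟩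

theorem γ_map₂ (f : E → F → G) (a : A) (x : gen A E ⊤) (y : gen A F ⊤) :
    (gen A G).γ a (map₂ f x y) = map₂ f ((gen A E).γ a x) ((gen A F).γ a y) := by
  refine Subtype.ext (funext fun z => ?_)
  show a ⊓ (⨆ r, ⨆ s, ⨆ _ : f r s = z, x.1 r ⊓ y.1 s) =
    ⨆ r, ⨆ s, ⨆ _ : f r s = z, (a ⊓ x.1 r) ⊓ (a ⊓ y.1 s)
  simp only [inf_iSup_eq]
  exact iSup_congr fun r => iSup_congr fun s => iSup_congr fun _ => inf_inf_distrib_left _ _ _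

theorem γ_map (f : E → G) (a : A) (x : gen A E ⊤) :
    (gen A G).γ a (map f x) = map f ((gen A E).γ a x) := by
  refine Subtype.ext (funext fun z => ?_)
  show a ⊓ (⨆ r, ⨆ _ : f r = z, x.1 r) = ⨆ r, ⨆ _ : f r = z, a ⊓ x.1 r
  simp only [inf_iSup_eq]

/-- `Val b x r`: the element `x` has the value `r` on the condition `b`. -/
def Val (b : A) {a : A} (x : gen A E a) (r : E) : Prop := b ≤ x.1 r

theorem Val.mono {b c : A} (h : c ≤ b) {a : A} {x : gen A E a} {r : E} (hx : Val b x r) :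
    Val c x r := h.trans hx

theorem Val.unique {b a : A} (hb : b ≠ ⊥) {x : gen A E a} {r s : E} (h : Val b x r)
    (h' : Val b x s) : r = s := by
  by_contra e
  exact hb (le_bot_iff.1 ((le_inf h h').trans (x.2.2 r s e).le))

theorem Val.map₂ (f : E → F → G) {b a : A} {x : gen A E a} {y : gen A F a} {r : E} {s : F}
    (hx : Val b x r) (hy : Val b y s) : Val b (map₂ f x y) (f r s) :=
  (le_inf hx hy).trans (le_iSup_of_le r (le_iSup_of_le s (le_iSup_of_le rfl le_rfl)))

theorem Val.map (f : E → G) {b a : A} {x : gen A E a} {r : E}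
    (hx : Val b x r) : Val b (map f x) (f r) :=
  le_trans hx (le_iSup_of_le r (le_iSup_of_le rfl le_rfl))

theorem Val.γ {b a : A} (h : b ≤ a) {x : gen A E ⊤} {r : E} (hx : Val b x r) :
    Val b ((gen A E).γ a x) r := le_inf h hx

theorem exists_val {b a : A} (hb : b ≠ ⊥) (h : b ≤ a) (x : gen A E a) :
    ∃ c ≤ b, c ≠ ⊥ ∧ ∃ r, Val c x r := by
  by_contra hcon
  push Not at hcon
  apply hb
  have : ∀ r, b ⊓ x.1 r = ⊥ := fun r => by
    by_contra hne
    exact hcon _ inf_le_left hne r inf_le_right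
  rw [← inf_eq_left.2 h, ← x.2.1, inf_iSup_eq, iSup_eq_bot]
  exact this

theorem rel_iff {R : E → F → Prop} {a : A} {x : gen A E a} {y : gen A F a} :
    Rel R x y ↔ ∀ b, b ≠ ⊥ → ∀ r s, Val b x r → Val b y s → R r s :=
  ⟨fun h _ hb r s hx hy => h r s fun e => hb (le_bot_iff.1 ((le_inf hx hy).trans e.le)),
    fun h r s hne => h _ hne r s inf_le_left inf_le_right⟩

end Gen

/-- The conditional natural numbers; the classical natural numbers start at `1` here. -/
abbrev CondNat (A : Type u) [CompleteBooleanAlgebra A] : CondSet.{u, u} A := gen A ℕ+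

/-- The conditional rational numbers. -/
abbrev CondRat (A : Type u) [CompleteBooleanAlgebra A] : CondSet.{u, u} A := gen A ℚ

/-- The conditional order of the conditional natural numbers. -/
def CondNat.le {a : A} (m n : CondNat A a) : Prop := Gen.Rel (· ≤ ·) m n

namespace CondRat

/-- The conditional strict order of the conditional rational numbers. -/
def lt {a : A} (x y : CondRat A a) : Prop := Gen.Rel (· < ·) x y

/-- Conditional negation. -/
def neg {a : A} (x : CondRat A a) : CondRat A a := Gen.map (fun r => -r) x

/-- Conditional addition. -/
def add {a : A} (x y : CondRat A a) : CondRat A a := Gen.map₂ (fun r s => r + s) x y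

/-- Conditional subtraction. -/
def sub {a : A} (x y : CondRat A a) : CondRat A a := Gen.map₂ (fun r s => r - s) x y

/-- The conditional absolute value. -/
def abs {a : A} (x : CondRat A a) : CondRat A a := Gen.map (fun r => |r|) x

/-- `ε ∈ Q₊₊`. -/
def Pos (ε : CondRat A ⊤) : Prop := lt (Gen.const A 0) ε

end CondRat

theorem CondFun.congr {X : CondSet.{u, v} A} {Y : CondSet.{u, w} A} (f : CondFun X Y) {a : A}
    {x y : X ⊤} (h : X.γ a x = X.γ a y) : Y.γ a (f.app ⊤ x) = Y.γ a (f.app ⊤ y) := by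
  rw [← f.natural, ← f.natural, h]

/-! ### The conditional real numbers -/

/-- Conditional sequences of conditional rational numbers. -/
abbrev RatSeq (A : Type u) [CompleteBooleanAlgebra A] := CondFun (CondNat A) (CondRat A)

namespace RatSeq

/-- Conditional Cauchy sequences of conditional rational numbers. -/
def IsCauchy (q : RatSeq A) : Prop :=
  ∀ ε : CondRat A ⊤, CondRat.Pos ε → ∃ n₀ : CondNat A ⊤, ∀ m n : CondNat A ⊤,
    CondNat.le n₀ m → CondNat.le n₀ n →
      CondRat.lt (CondRat.abs (CondRat.sub (q.app ⊤ m) (q.app ⊤ n))) ε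

/-- On the condition `a`, the difference of the sequences converges conditionally to `0`. -/
def Equiv (a : A) (q p : RatSeq A) : Prop :=
  ∀ ε : CondRat A ⊤, CondRat.Pos ε → ∃ n₀ : CondNat A ⊤, ∀ n : CondNat A ⊤, CondNat.le n₀ n →
    CondRat.lt ((CondRat A).γ a (CondRat.abs (CondRat.sub (q.app ⊤ n) (p.app ⊤ n))))
      ((CondRat A).γ a ε)

/-- On the condition `a`, for every positive `ε` eventually `p n - q n > - ε`. -/
def Le (a : A) (q p : RatSeq A) : Prop :=
  ∀ ε : CondRat A ⊤, CondRat.Pos ε → ∃ n₀ : CondNat A ⊤, ∀ n : CondNat A ⊤, CondNat.le n₀ n →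
    CondRat.lt ((CondRat A).γ a (CondRat.neg ε))
      ((CondRat A).γ a (CondRat.sub (p.app ⊤ n) (q.app ⊤ n)))

/-- The pointwise sum. -/
def add (q p : RatSeq A) : RatSeq A where
  app a n := CondRat.add (q.app a n) (p.app a n)
  natural a n := by
    rw [q.natural, p.natural]
    exact (Gen.γ_map₂ _ a _ _).symm

/-- The constant sequence `0`. -/
noncomputable def zero (A : Type u) [CompleteBooleanAlgebra A] : RatSeq A where
  app a _ := (CondRat A).γ a (Gen.const A 0)
  natural a _ := by rw [(CondRat A).identity]

end RatSeq

namespace Gen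

variable {E : Type} [Inhabited E]

theorem Val.congr {a b : A} (hb : b ≤ a) {x y : gen A E ⊤}
    (h : (gen A E).γ a x = (gen A E).γ a y) {r : E} (hx : Val b x r) : Val b y r := by
  have h1 : b ≤ a ⊓ x.1 r := le_inf hb hx
  have h2 : a ⊓ x.1 r = a ⊓ y.1 r := congrFun (congrArg Subtype.val h) r
  exact (h1.trans h2.le).trans inf_le_right

theorem Val.of_γ {a b : A} {x : gen A E ⊤} {r : E} (h : Val b ((gen A E).γ a x) r) :
    Val b x r := le_trans h inf_le_right

theorem val_le {a b : A} {x : gen A E a} {r : E} (h : Val b x r) : b ≤ a := le_trans h (x.2.le r)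

theorem val_const {b : A} (z : E) : Val b (const A z) z := by
  have h : (const A z).1 z = ⊤ := if_pos rfl
  exact le_top.trans h.ge

theorem le_max_left (m n : CondNat A ⊤) : CondNat.le m (map₂ max m n) := by
  refine rel_iff.2 fun b hb r s hr hs => ?_
  obtain ⟨c, hc, hc0, t, ht⟩ := exists_val hb le_top n
  rw [Val.unique hc0 (hs.mono hc) (Val.map₂ max (hr.mono hc) ht)]
  exact le_sup_left

theorem le_max_right (m n : CondNat A ⊤) : CondNat.le n (map₂ max m n) := by
  refine rel_iff.2 fun b hb r s hr hs => ?_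
  obtain ⟨c, hc, hc0, t, ht⟩ := exists_val hb le_top m
  rw [Val.unique hc0 (hs.mono hc) (Val.map₂ max ht (hr.mono hc))]
  exact le_sup_right

theorem nat_le_trans {l m n : CondNat A ⊤} (h : CondNat.le l m) (h' : CondNat.le m n) :
    CondNat.le l n := by
  refine rel_iff.2 fun b hb r s hr hs => ?_
  obtain ⟨c, hc, hc0, t, ht⟩ := exists_val hb le_top m
  exact (rel_iff.1 h c hc0 r t (hr.mono hc) ht).trans (rel_iff.1 h' c hc0 t s ht (hs.mono hc))

theorem nat_le_refl {a : A} (n : CondNat A a) : CondNat.le n n :=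
  rel_iff.2 fun _ hb _ _ hr hs => le_of_eq (Val.unique hb hr hs)

theorem exists_adjust {a : A} {n n₀ n₁ : CondNat A ⊤} (h : CondNat.le n₀ n)
    (e : (CondNat A).γ a n₀ = (CondNat A).γ a n₁) :
    ∃ n', CondNat.le n₁ n' ∧ (CondNat A).γ a n' = (CondNat A).γ a n := by
  obtain ⟨n', hn', hn''⟩ := (CondNat A).exists_pair a ((CondNat A).γ a n) ((CondNat A).γ aᶜ n₁)
  refine ⟨n', rel_iff.2 fun b hb r s hr hs => ?_, hn'⟩
  by_cases h0 : b ⊓ a = ⊥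
  · have hba : b ≤ aᶜ := le_compl_iff_disjoint_right.2 (disjoint_iff.2 h0)
    exact le_of_eq (Val.unique hb hr (Val.congr hba hn'' hs))
  · exact rel_iff.1 h _ h0 r s (Val.congr inf_le_right e.symm (hr.mono inf_le_left))
      (Val.congr inf_le_right hn' (hs.mono inf_le_left))

theorem exists_inf_ne_bot {ι : Type u} {p : ι → A} {a b : A} (hp : (⨆ i, p i) = a) (hb : b ≠ ⊥)
    (hba : b ≤ a) : ∃ i, b ⊓ p i ≠ ⊥ := by
  by_contra hcon
  push Not at hcon
  apply hb
  rw [← inf_eq_left.2 hba, ← hp, inf_iSup_eq, iSup_eq_bot]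
  exact hcon

theorem pos_iff {ε : CondRat A ⊤} :
    CondRat.Pos ε ↔ ∀ b, b ≠ ⊥ → ∀ t, Val b ε t → 0 < t := by
  refine rel_iff.trans ⟨fun h b hb t ht => h b hb 0 t (val_const 0) ht,
    fun h b hb r t hr ht => ?_⟩
  rw [Val.unique hb hr (val_const 0)]
  exact h b hb t ht

theorem pos_half {ε : CondRat A ⊤} (h : CondRat.Pos ε) :
    CondRat.Pos (map (fun t : ℚ => t / 2) ε) := by
  refine pos_iff.2 fun b hb t ht => ?_
  obtain ⟨c, hc, hc0, s, hs⟩ := exists_val hb le_top ε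
  rw [Val.unique hc0 (ht.mono hc) (Val.map _ hs)]
  exact half_pos (pos_iff.1 h c hc0 s hs)

end Gen

namespace RatSeq

open Gen

/-- Auxiliary common form of the relations `Equiv` and `Le` in terms of values. -/
def Forced (Φ : ℚ → ℚ → ℚ → Prop) (a : A) (q p : RatSeq A) : Prop :=
  ∀ ε : CondRat A ⊤, CondRat.Pos ε → ∃ n₀ : CondNat A ⊤, ∀ n : CondNat A ⊤, CondNat.le n₀ n →
    ∀ b, b ≠ ⊥ → b ≤ a → ∀ r s t, Val b (q.app ⊤ n) r → Val b (p.app ⊤ n) s → Val b ε t → Φ r s t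

theorem equiv_iff {a : A} {q p : RatSeq A} :
    Equiv a q p ↔ Forced (fun r s t => |r - s| < t) a q p := by
  refine forall_congr' fun ε => imp_congr_right fun hε => exists_congr fun n₀ =>
    forall_congr' fun n => imp_congr_right fun hn => rel_iff.trans ⟨?_, ?_⟩
  · intro h b hb hba r s t hr hs ht
    exact h b hb _ t (((hr.map₂ _ hs).map _).γ hba) (ht.γ hba)
  · intro h b hb x t hx ht
    obtain ⟨c, hc, hc0, r, hr⟩ := exists_val hb le_top (q.app ⊤ n)
    obtain ⟨d, hd, hd0, s, hs⟩ := exists_val hc0 le_top (p.app ⊤ n)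
    rw [Val.unique hd0 (hx.of_γ.mono (hd.trans hc)) (((hr.mono hd).map₂ _ hs).map _)]
    exact h d hd0 ((hd.trans hc).trans (val_le hx)) r s t (hr.mono hd) hs
      (ht.of_γ.mono (hd.trans hc))

theorem le_iff {a : A} {q p : RatSeq A} :
    Le a q p ↔ Forced (fun r s t => -t < s - r) a q p := by
  refine forall_congr' fun ε => imp_congr_right fun hε => exists_congr fun n₀ =>
    forall_congr' fun n => imp_congr_right fun hn => rel_iff.trans ⟨?_, ?_⟩
  · intro h b hb hba r s t hr hs ht
    exact h b hb _ _ ((ht.map _).γ hba) ((hs.map₂ _ hr).γ hba)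
  · intro h b hb y x hy hx
    obtain ⟨c, hc, hc0, r, hr⟩ := exists_val hb le_top (q.app ⊤ n)
    obtain ⟨d, hd, hd0, s, hs⟩ := exists_val hc0 le_top (p.app ⊤ n)
    obtain ⟨e, he, he0, t, ht⟩ := exists_val hd0 le_top ε
    have hb' := he.trans (hd.trans hc)
    rw [Val.unique he0 (hx.of_γ.mono hb') ((hs.mono he).map₂ _ (hr.mono (he.trans hd))),
      Val.unique he0 (hy.of_γ.mono hb') (ht.map _)]
    exact h e he0 (hb'.trans (val_le hx)) r s t (hr.mono (he.trans hd)) (hs.mono he) ht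

theorem isCauchy_iff {q : RatSeq A} : IsCauchy q ↔
    ∀ ε : CondRat A ⊤, CondRat.Pos ε → ∃ n₀ : CondNat A ⊤, ∀ m n : CondNat A ⊤,
    CondNat.le n₀ m → CondNat.le n₀ n → ∀ b, b ≠ ⊥ → ∀ r s t, Val b (q.app ⊤ m) r →
      Val b (q.app ⊤ n) s → Val b ε t → |r - s| < t := by
  refine forall_congr' fun ε => imp_congr_right fun hε => exists_congr fun n₀ =>
    forall_congr' fun m => forall_congr' fun n => imp_congr_right fun hm =>
    imp_congr_right fun hn => rel_iff.trans ⟨?_, ?_⟩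
  · intro h b hb r s t hr hs ht
    exact h b hb _ t ((hr.map₂ _ hs).map _) ht
  · intro h b hb x t hx ht
    obtain ⟨c, hc, hc0, r, hr⟩ := exists_val hb le_top (q.app ⊤ m)
    obtain ⟨d, hd, hd0, s, hs⟩ := exists_val hc0 le_top (q.app ⊤ n)
    rw [Val.unique hd0 (hx.mono (hd.trans hc)) (((hr.mono hd).map₂ _ hs).map _)]
    exact h d hd0 r s t (hr.mono hd) hs (ht.mono (hd.trans hc))

theorem Forced.mono {Φ : ℚ → ℚ → ℚ → Prop} {a b : A} (hab : a ≤ b) {q p : RatSeq A}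
    (h : Forced Φ b q p) : Forced Φ a q p := fun ε hε =>
  (h ε hε).imp fun _ hn₀ n hn c hc hca => hn₀ n hn c hc (hca.trans hab)

theorem Forced.glue {Φ : ℚ → ℚ → ℚ → Prop} {ι : Type u} {P : ι → A} {a : A} (hP : IsPart P a)
    {q p : RatSeq A} (h : ∀ i, Forced Φ (P i) q p) : Forced Φ a q p := by
  intro ε hε
  choose N hN using fun i => h i ε hε
  obtain ⟨n₁, hn₁, -⟩ := (CondNat A).exists_glue hP (fun i => (CondNat A).γ (P i) (N i))
  obtain ⟨n₀, rfl⟩ := (CondNat A).surjective a n₁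
  refine ⟨n₀, fun n hn b hb hba r s t hr hs ht => ?_⟩
  obtain ⟨i, hi⟩ := exists_inf_ne_bot hP.1 hb hba
  obtain ⟨n', hn', e⟩ := exists_adjust hn (((CondNat A).res_γ _ n₀).symm.trans (hn₁ i))
  exact hN i n' hn' _ hi inf_le_right r s t
    (Val.congr inf_le_right (q.congr e.symm) (hr.mono inf_le_left))
    (Val.congr inf_le_right (p.congr e.symm) (hs.mono inf_le_left)) (ht.mono inf_le_left)

theorem Forced.comp {Φ₁ Φ₂ Φ₃ : ℚ → ℚ → ℚ → Prop} {a : A} {q p o : RatSeq A}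
    (hΦ : ∀ r s x t, Φ₁ r s (t / 2) → Φ₂ s x (t / 2) → Φ₃ r x t)
    (h₁ : Forced Φ₁ a q p) (h₂ : Forced Φ₂ a p o) : Forced Φ₃ a q o := by
  intro ε hε
  obtain ⟨n₁, hn₁⟩ := h₁ _ (pos_half hε)
  obtain ⟨n₂, hn₂⟩ := h₂ _ (pos_half hε)
  refine ⟨map₂ max n₁ n₂, fun n hn b hb hba r x t hr hx ht => ?_⟩
  obtain ⟨c, hc, hc0, s, hs⟩ := exists_val hb le_top (p.app ⊤ n)
  have ht' := (ht.mono hc).map (fun t : ℚ => t / 2)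
  exact hΦ r s x t
    (hn₁ n (nat_le_trans (le_max_left _ _) hn) c hc0 (hc.trans hba) r s _ (hr.mono hc) hs ht')
    (hn₂ n (nat_le_trans (le_max_right _ _) hn) c hc0 (hc.trans hba) s x _ hs (hx.mono hc) ht')

theorem Forced.add {Φ₁ Φ₂ Φ₃ : ℚ → ℚ → ℚ → Prop} {a : A} {q p q' p' : RatSeq A}
    (hΦ : ∀ r s r' s' t, Φ₁ r s (t / 2) → Φ₂ r' s' (t / 2) → Φ₃ (r + r') (s + s') t)
    (h₁ : Forced Φ₁ a q p) (h₂ : Forced Φ₂ a q' p') : Forced Φ₃ a (q.add q') (p.add p') := by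
  intro ε hε
  obtain ⟨n₁, hn₁⟩ := h₁ _ (pos_half hε)
  obtain ⟨n₂, hn₂⟩ := h₂ _ (pos_half hε)
  refine ⟨map₂ max n₁ n₂, fun n hn b hb hba x y t hx hy ht => ?_⟩
  obtain ⟨c, hc, hc0, r, hr⟩ := exists_val hb le_top (q.app ⊤ n)
  obtain ⟨d, hd, hd0, s, hs⟩ := exists_val hc0 le_top (p.app ⊤ n)
  obtain ⟨e, he, he0, r', hr'⟩ := exists_val hd0 le_top (q'.app ⊤ n)
  obtain ⟨f, hf, hf0, s', hs'⟩ := exists_val he0 le_top (p'.app ⊤ n)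
  have hfb := hf.trans (he.trans (hd.trans hc))
  have ht' := (ht.mono hfb).map (fun t : ℚ => t / 2)
  replace hr := hr.mono (hf.trans (he.trans hd))
  replace hs := hs.mono (hf.trans he)
  replace hr' := hr'.mono hf
  rw [Val.unique hf0 (hx.mono hfb) (hr.map₂ _ hr'), Val.unique hf0 (hy.mono hfb) (hs.map₂ _ hs')]
  exact hΦ r s r' s' t
    (hn₁ n (nat_le_trans (le_max_left _ _) hn) f hf0 (hfb.trans hba) r s _ hr hs ht')
    (hn₂ n (nat_le_trans (le_max_right _ _) hn) f hf0 (hfb.trans hba) r' s' _ hr' hs' ht')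

theorem Equiv.refl (a : A) (q : RatSeq A) : Equiv a q q := by
  refine equiv_iff.2 fun ε hε => ⟨const A 1, fun n _ b hb _ r s t hr hs ht => ?_⟩
  rw [Val.unique hb hr hs]
  show |s - s| < t
  rw [sub_self, abs_zero]
  exact pos_iff.1 hε b hb t ht

theorem Equiv.symm {a : A} {q p : RatSeq A} (h : Equiv a q p) : Equiv a p q := by
  refine equiv_iff.2 fun ε hε => (equiv_iff.1 h ε hε).imp
    fun n₀ hn₀ n hn b hb hba r s t hr hs ht => ?_
  show |r - s| < t
  rw [abs_sub_comm]
  exact hn₀ n hn b hb hba s r t hs hr ht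

theorem Equiv.trans {a : A} {q p o : RatSeq A} (h : Equiv a q p) (h' : Equiv a p o) :
    Equiv a q o := by
  refine equiv_iff.2 (Forced.comp (fun r s x t h1 h2 => ?_) (equiv_iff.1 h) (equiv_iff.1 h'))
  rw [abs_lt] at *
  constructor <;> linarith

theorem Equiv.mono {a b : A} (hab : a ≤ b) {q p : RatSeq A} (h : Equiv b q p) : Equiv a q p :=
  equiv_iff.2 ((equiv_iff.1 h).mono hab)

theorem Equiv.add {a : A} {q p q' p' : RatSeq A} (h : Equiv a q p) (h' : Equiv a q' p') :
    Equiv a (q.add q') (p.add p') := by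
  refine equiv_iff.2 (Forced.add (fun r s r' s' t h1 h2 => ?_) (equiv_iff.1 h) (equiv_iff.1 h'))
  rw [abs_lt] at *
  constructor <;> linarith

theorem Equiv.le {a : A} {q p : RatSeq A} (h : Equiv a q p) : Le a q p := by
  refine le_iff.2 fun ε hε => (equiv_iff.1 h ε hε).imp
    fun n₀ hn₀ n hn b hb hba r s t hr hs ht => ?_
  have := (abs_lt.1 (hn₀ n hn b hb hba r s t hr hs ht)).2
  linarith

theorem Le.trans {a : A} {q p o : RatSeq A} (h : Le a q p) (h' : Le a p o) : Le a q o :=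
  le_iff.2 (Forced.comp (fun r s x t h1 h2 => by linarith) (le_iff.1 h) (le_iff.1 h'))

theorem IsCauchy.add {q p : RatSeq A} (hq : IsCauchy q) (hp : IsCauchy p) :
    IsCauchy (q.add p) := by
  refine isCauchy_iff.2 fun ε hε => ?_
  obtain ⟨n₁, hn₁⟩ := isCauchy_iff.1 hq _ (pos_half hε)
  obtain ⟨n₂, hn₂⟩ := isCauchy_iff.1 hp _ (pos_half hε)
  refine ⟨map₂ max n₁ n₂, fun m n hm hn b hb x y t hx hy ht => ?_⟩
  obtain ⟨c, hc, hc0, r, hr⟩ := exists_val hb le_top (q.app ⊤ m)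
  obtain ⟨d, hd, hd0, s, hs⟩ := exists_val hc0 le_top (q.app ⊤ n)
  obtain ⟨e, he, he0, r', hr'⟩ := exists_val hd0 le_top (p.app ⊤ m)
  obtain ⟨f, hf, hf0, s', hs'⟩ := exists_val he0 le_top (p.app ⊤ n)
  have hfb := hf.trans (he.trans (hd.trans hc))
  have ht' := (ht.mono hfb).map (fun t : ℚ => t / 2)
  replace hr := hr.mono (hf.trans (he.trans hd))
  replace hs := hs.mono (hf.trans he)
  replace hr' := hr'.mono hf
  rw [Val.unique hf0 (hx.mono hfb) (hr.map₂ _ hr'), Val.unique hf0 (hy.mono hfb) (hs.map₂ _ hs')]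
  have h1 := hn₁ m n (nat_le_trans (le_max_left _ _) hm) (nat_le_trans (le_max_left _ _) hn)
    f hf0 r s _ hr hs ht'
  have h2 := hn₂ m n (nat_le_trans (le_max_right _ _) hm) (nat_le_trans (le_max_right _ _) hn)
    f hf0 r' s' _ hr' hs' ht'
  rw [abs_lt] at *
  constructor <;> linarith

theorem isCauchy_zero : IsCauchy (zero A) := by
  refine isCauchy_iff.2 fun ε hε => ⟨const A 1, fun m n _ _ b hb r s t hr hs ht => ?_⟩
  rw [Val.unique hb hr hs, sub_self, abs_zero]
  exact pos_iff.1 hε b hb t ht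

theorem exists_glue {ι : Type u} (P : ι → A) (hP : IsPart P ⊤) (s : ι → RatSeq A)
    (hs : ∀ i, IsCauchy (s i)) : ∃ q : RatSeq A, IsCauchy q ∧ ∀ i, Equiv (P i) q (s i) := by
  choose G hG hG' using fun n : CondNat A ⊤ =>
    (CondRat A).stability P hP (fun i => (CondRat A).γ (P i) ((s i).app ⊤ n))
  have hloc : ∀ a x y, (CondNat A).γ a x = (CondNat A).γ a y →
      (CondRat A).γ a (G x) = (CondRat A).γ a (G y) := by
    intro a x y h
    refine (CondRat A).ext_cover_top (hP.inf_of_le (le_top : a ≤ ⊤)).1 _ _ fun i => ?_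
    have e : ∀ n, (CondRat A).γ (a ⊓ P i) (G n) = (CondRat A).γ (a ⊓ P i) ((s i).app ⊤ n) :=
      fun n => (CondRat A).consistency inf_le_right _ _ (hG n i)
    rw [e, e]
    exact (CondRat A).consistency inf_le_left _ _ ((s i).congr h)
  have hval : ∀ i n b r, b ≤ P i → Val b ((CondFun.ofTop G hloc).app ⊤ n) r →
      Val b ((s i).app ⊤ n) r := by
    intro i n b r hb h
    rw [CondFun.ofTop_app_top] at h
    exact Val.congr hb (hG n i) h
  refine ⟨CondFun.ofTop G hloc, isCauchy_iff.2 fun ε hε => ?_, fun i => equiv_iff.2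
    fun ε hε => ⟨const A 1, fun n _ b hb hbi r x t hr hx ht => ?_⟩⟩
  · choose N hN using fun i => isCauchy_iff.1 (hs i) ε hε
    obtain ⟨n₀, hn₀, -⟩ := (CondNat A).stability P hP (fun i => (CondNat A).γ (P i) (N i))
    refine ⟨n₀, fun m n hm hn b hb r x t hr hx ht => ?_⟩
    obtain ⟨i, hi⟩ := exists_inf_ne_bot hP.1 hb le_top
    obtain ⟨m', hm', em⟩ := exists_adjust hm (hn₀ i)
    obtain ⟨n', hn', en⟩ := exists_adjust hn (hn₀ i)
    exact hN i m' n' hm' hn' _ hi r x t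
      (Val.congr inf_le_right ((s i).congr em.symm)
        (hval i m _ r inf_le_right (hr.mono inf_le_left)))
      (Val.congr inf_le_right ((s i).congr en.symm)
        (hval i n _ x inf_le_right (hx.mono inf_le_left))) (ht.mono inf_le_left)
  · rw [Val.unique hb (hval i n b r hbi hr) hx]
    show |x - x| < t
    rw [sub_self, abs_zero]
    exact pos_iff.1 hε b hb t ht

/-- The conditional equivalence relation on conditional Cauchy sequences, on the condition `a`. -/
def setoid (a : A) : Setoid {q : RatSeq A // IsCauchy q} where
  r q p := Equiv a q.1 p.1
  iseqv := ⟨fun q => Equiv.refl a q.1, Equiv.symm, Equiv.trans⟩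

end RatSeq

/-- The conditional real numbers: the conditional quotient of the conditional Cauchy sequences of
conditional rational numbers. -/
def CondReal (A : Type u) [CompleteBooleanAlgebra A] : CondSet.{u, u} A where
  carrier a := Quotient (RatSeq.setoid a)
  γ a := Quotient.map' id fun _ _ h => RatSeq.Equiv.mono le_top h
  bot_singleton := by
    refine ⟨Quotient.mk _ ⟨_, RatSeq.isCauchy_zero⟩, fun y => ?_⟩
    induction y using Quotient.inductionOn with
    | _ y =>
      exact Quotient.sound (RatSeq.equiv_iff.2 fun ε _ => ⟨Gen.const A 1,
        fun n _ b hb hb' => absurd (le_bot_iff.1 hb') hb⟩)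
  surjective a y := by
    induction y using Quotient.inductionOn with
    | _ y => exact ⟨Quotient.mk _ y, rfl⟩
  identity y := by
    induction y using Quotient.inductionOn with
    | _ y => rfl
  consistency hab x y h := by
    induction x using Quotient.inductionOn with
    | _ x =>
      induction y using Quotient.inductionOn with
      | _ y => exact Quotient.sound (RatSeq.Equiv.mono hab (Quotient.exact h))
  stability {ι} P hP x := by
    obtain ⟨q, hq, hqs⟩ := RatSeq.exists_glue P hP (fun i => (x i).out.1) (fun i => (x i).out.2)
    refine ⟨Quotient.mk _ ⟨q, hq⟩, fun i => ?_, fun y hy => ?_⟩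
    · rw [← Quotient.out_eq (x i)]
      exact Quotient.sound (hqs i)
    · induction y using Quotient.inductionOn with
      | _ y =>
        refine Quotient.sound (RatSeq.equiv_iff.2 (RatSeq.Forced.glue hP fun i =>
          RatSeq.equiv_iff.1 (RatSeq.Equiv.trans (p := (x i).out.1) ?_ (hqs i).symm)))
        have h := hy i
        rw [← Quotient.out_eq (x i)] at h
        exact Quotient.exact h

namespace CondReal

/-- The conditional order of the conditional real numbers. -/
def le {a : A} (x y : CondReal A a) : Prop :=
  Quotient.liftOn₂ x y (fun q p => RatSeq.Le a q.1 p.1) fun _ _ _ _ h h' => propext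
    ⟨fun hl => (h.symm.le.trans hl).trans h'.le, fun hl => (h.le.trans hl).trans h'.symm.le⟩

/-- The conditional sum. -/
def add {a : A} (x y : CondReal A a) : CondReal A a :=
  Quotient.liftOn₂ x y
    (fun q p => Quotient.mk (RatSeq.setoid a) ⟨q.1.add p.1, RatSeq.IsCauchy.add q.2 p.2⟩)
    fun _ _ _ _ h h' => Quotient.sound (RatSeq.Equiv.add h h')

/-- The conditional real number `0`. -/
noncomputable def zero (A : Type u) [CompleteBooleanAlgebra A] : CondReal A ⊤ :=
  Quotient.mk _ ⟨_, RatSeq.isCauchy_zero⟩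

/-- The strict order: `x ≤ y`, and `b x = b y` only for `b = ⊥`. -/
def lt {a : A} (x y : CondReal A a) : Prop :=
  le x y ∧ ∀ b (h : b ≤ a), (CondReal A).res h x = (CondReal A).res h y → b = ⊥

/-- `ε ∈ R₊₊`. -/
def Pos (ε : CondReal A ⊤) : Prop := lt (zero A) ε

theorem le_γ {a : A} {x y : CondReal A ⊤} (h : le x y) :
    le ((CondReal A).γ a x) ((CondReal A).γ a y) := by
  induction x using Quotient.inductionOn with
  | _ x =>
    induction y using Quotient.inductionOn with
    | _ y => exact RatSeq.le_iff.2 ((RatSeq.le_iff.1 h).mono le_top)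

theorem le_res {a b : A} (hab : a ≤ b) {x y : CondReal A b} (h : le x y) :
    le ((CondReal A).res hab x) ((CondReal A).res hab y) := by
  obtain ⟨x, rfl⟩ := (CondReal A).surjective b x
  obtain ⟨y, rfl⟩ := (CondReal A).surjective b y
  rw [CondSet.res_γ, CondSet.res_γ]
  induction x using Quotient.inductionOn with
  | _ x =>
    induction y using Quotient.inductionOn with
    | _ y => exact RatSeq.le_iff.2 ((RatSeq.le_iff.1 h).mono hab)

theorem le_glue {ι : Type u} {p : ι → A} {a : A} (hp : IsPart p a) {x y : CondReal A a}
    (h : ∀ i, le ((CondReal A).res (hp.le i) x) ((CondReal A).res (hp.le i) y)) : le x y := by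
  obtain ⟨x, rfl⟩ := (CondReal A).surjective a x
  obtain ⟨y, rfl⟩ := (CondReal A).surjective a y
  simp only [CondSet.res_γ] at h
  induction x using Quotient.inductionOn with
  | _ x =>
    induction y using Quotient.inductionOn with
    | _ y => exact RatSeq.le_iff.2 (RatSeq.Forced.glue hp fun i => RatSeq.le_iff.1 (h i))

theorem lt_res {a b : A} (hab : a ≤ b) {x y : CondReal A b} (h : lt x y) :
    lt ((CondReal A).res hab x) ((CondReal A).res hab y) := by
  refine ⟨le_res hab h.1, fun c hc e => h.2 c (hc.trans hab) ?_⟩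
  rwa [CondSet.res_res, CondSet.res_res] at e

theorem lt_glue {ι : Type u} {p : ι → A} {a : A} (hp : IsPart p a) {x y : CondReal A a}
    (h : ∀ i, lt ((CondReal A).res (hp.le i) x) ((CondReal A).res (hp.le i) y)) : lt x y := by
  refine ⟨le_glue hp fun i => (h i).1, fun b hb e => ?_⟩
  by_contra hne
  obtain ⟨i, hi⟩ := Gen.exists_inf_ne_bot hp.1 hne hb
  refine hi ((h i).2 _ inf_le_right ?_)
  have := congrArg ((CondReal A).res (inf_le_left : b ⊓ p i ≤ b)) e
  rw [CondSet.res_res, CondSet.res_res] at this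
  rw [CondSet.res_res, CondSet.res_res]
  exact this

end CondReal

/-! ### Conditional topologies, compactness and metric spaces -/

/-- A conditional topology on `X`: a conditional subset of the conditional power set containing
`𝟎` and `X` and closed under finite intersections and arbitrary unions. -/
structure CondTopology (X : CondSet.{u, v} A) where
  opens : CondSubset X.powerset
  empty_mem : ⟨CondSubset.empty X, fun _ _ => le_top⟩ ∈ opens.sec ⊤
  univ_mem : ⟨CondSubset.univ X, fun _ _ => le_top⟩ ∈ opens.sec ⊤
  inter_mem : ∀ O₁ ∈ opens.sec ⊤, ∀ O₂ ∈ opens.sec ⊤,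
    ⟨CondSubset.inter O₁.1 O₂.1, fun _ _ => le_top⟩ ∈ opens.sec ⊤
  sUnion_mem : ∀ S ⊆ opens.sec ⊤,
    ⟨CondSubset.sUnion (Subtype.val '' S), fun _ _ => le_top⟩ ∈ opens.sec ⊤

namespace CondTopology

variable {X : CondSet.{u, v} A}

/-- `O` is conditionally open. -/
def IsOpen (T : CondTopology X) (O : CondSubset X) : Prop :=
  (⟨O, fun _ _ => le_top⟩ : X.powerset ⊤) ∈ T.opens.sec ⊤

/-- The conditional topology generated by `G`: the conditional intersection of all conditional
topologies containing `G`. -/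
def generate (G : Set (CondSubset X)) : CondTopology X where
  opens :=
    { sec := fun a => {O | ∀ T : CondTopology X, (∀ U ∈ G, T.IsOpen U) → O ∈ T.opens.sec a}
      res_mem := fun h _ hO T hT => T.opens.res_mem h (hO T hT)
      glue_mem := fun p hp O hO T hT => T.opens.glue_mem p hp O fun i => hO i T hT }
  empty_mem T _ := T.empty_mem
  univ_mem T _ := T.univ_mem
  inter_mem O₁ h₁ O₂ h₂ T hT := T.inter_mem O₁ (h₁ T hT) O₂ (h₂ T hT)
  sUnion_mem S hS T hT := T.sUnion_mem S fun _ hO => hS hO T hT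

/-- `U` lives on `⊤` and is a conditional neighborhood of `x`. -/
def IsNhd (T : CondTopology X) (U : CondSubset X) (x : X ⊤) : Prop :=
  ∃ O, T.IsOpen O ∧ x ∈ O.sec ⊤ ∧ O ≤ U

end CondTopology

/-- The conditional set `{k | 1 ≤ k ≤ n}` for a conditional natural number `n`. -/
def CondNat.initial (n : CondNat A ⊤) : CondSubset (CondNat A) where
  sec a := {k | CondNat.le k ((CondNat A).γ a n)}
  res_mem {a b} h k hk := by
    obtain ⟨k, rfl⟩ := (CondNat A).surjective b k
    rw [CondSet.res_γ]
    refine Gen.rel_iff.2 fun c hc r s hr hs => ?_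
    have hca := Gen.val_le hr
    exact Gen.rel_iff.1 hk c hc r s (hr.of_γ.γ (hca.trans h)) (hs.of_γ.γ (hca.trans h))
  glue_mem {a ι} p hp k hk := by
    obtain ⟨k, rfl⟩ := (CondNat A).surjective a k
    simp only [CondSet.res_γ] at hk
    refine Gen.rel_iff.2 fun c hc r s hr hs => ?_
    obtain ⟨i, hi⟩ := Gen.exists_inf_ne_bot hp.1 hc (Gen.val_le hr)
    exact Gen.rel_iff.1 (hk i) _ hi r s ((hr.of_γ.mono inf_le_left).γ inf_le_right)
      ((hs.of_γ.mono inf_le_left).γ inf_le_right)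

/-- `{k | 1 ≤ k ≤ n}` as a conditional set, the index set of conditionally finite families. -/
def CondNat.segment (n : CondNat A ⊤) : CondSet.{u, u} A :=
  (CondNat.initial n).toCondSet ⟨n, by
    show CondNat.le n ((CondNat A).γ ⊤ n)
    rw [CondSet.identity]
    exact Gen.nat_le_refl n⟩

namespace CondTopology

variable {X : CondSet.{u, v} A}

/-- Conditional compactness: every conditional family `(O j)`, `j ∈ J`, of conditionally open sets
with `X ⊑ ⊔ O j` has a conditionally finite subfamily `(O (k l))`, `1 ≤ l ≤ n`, with the same
property. -/
def IsCompact (T : CondTopology X) : Prop :=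
  ∀ (J : CondSet.{u, max u v} A) (O : CondFun J X.powerset),
    (∀ j : J ⊤, T.IsOpen (O.app ⊤ j).1) →
    CondSubset.univ X ≤ CondSubset.sUnion (Set.range fun j : J ⊤ => (O.app ⊤ j).1) →
    ∃ (n : CondNat A ⊤) (k : CondFun (CondNat.segment n) J),
      CondSubset.univ X ≤ CondSubset.sUnion
        (Set.range fun l : CondNat.segment n ⊤ => (O.app ⊤ (k.app ⊤ l)).1)

end CondTopology

/-- A conditional metric on `X`, with values in the non-negative conditional real numbers. -/
structure CondMetric (X : CondSet.{u, v} A) where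
  dist : CondFun (X.prod X) (CondReal A)
  nonneg : ∀ x y : X ⊤, CondReal.le (CondReal.zero A) (dist.app ⊤ (x, y))
  eq_zero_iff : ∀ x y : X ⊤, dist.app ⊤ (x, y) = CondReal.zero A ↔ x = y
  symm : ∀ x y : X ⊤, dist.app ⊤ (x, y) = dist.app ⊤ (y, x)
  triangle : ∀ x y z : X ⊤, CondReal.le (dist.app ⊤ (x, z))
    (CondReal.add (dist.app ⊤ (x, y)) (dist.app ⊤ (y, z)))

namespace CondMetric

variable {X : CondSet.{u, v} A} (d : CondMetric X)

theorem res_dist {a b : A} (h : a ≤ b) (x y : X b) :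
    (CondReal A).res h (d.dist.app b (x, y)) = d.dist.app a (X.res h x, X.res h y) := by
  obtain ⟨x, rfl⟩ := X.surjective b x
  obtain ⟨y, rfl⟩ := X.surjective b y
  have e : ∀ c, d.dist.app c (X.γ c x, X.γ c y) = (CondReal A).γ c (d.dist.app ⊤ (x, y)) :=
    fun c => d.dist.natural c (x, y)
  rw [CondSet.res_γ, CondSet.res_γ, e, e, CondSet.res_γ]

/-- The conditional open ball `B_ε(x) = {y | d(x, y) < ε}`. -/
def ball (x : X ⊤) (ε : CondReal A ⊤) : CondSubset X where
  sec a := {y | CondReal.lt (d.dist.app a (X.γ a x, y)) ((CondReal A).γ a ε)}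
  res_mem h y hy := by
    have := CondReal.lt_res h hy
    rwa [res_dist, CondSet.res_γ, CondSet.res_γ] at this
  glue_mem p hp y hy := by
    refine CondReal.lt_glue hp fun i => ?_
    rw [res_dist, CondSet.res_γ, CondSet.res_γ]
    exact hy i

/-- The conditional topology generated by the conditional open balls. -/
def topology : CondTopology X :=
  CondTopology.generate {B | ∃ (x : X ⊤) (ε : CondReal A ⊤), CondReal.Pos ε ∧ B = d.ball x ε}

/-- Conditional compactness of a conditional metric space. -/
def Compact : Prop := d.topology.IsCompact

/-- A conditional sequence is conditionally Cauchy. -/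
def IsCauchy (x : CondFun (CondNat A) X) : Prop :=
  ∀ ε : CondReal A ⊤, CondReal.Pos ε → ∃ n₀ : CondNat A ⊤, ∀ n m : CondNat A ⊤,
    CondNat.le n₀ n → CondNat.le n₀ m →
      CondReal.le (d.dist.app ⊤ (x.app ⊤ n, x.app ⊤ m)) ε

/-- `z` is a conditional limit point of the conditional sequence `x`. -/
def IsLimit (x : CondFun (CondNat A) X) (z : X ⊤) : Prop :=
  ∀ U : CondSubset X, d.topology.IsNhd U z → ∃ n₀ : CondNat A ⊤, ∀ n : CondNat A ⊤,
    CondNat.le n₀ n → x.app ⊤ n ∈ U.sec ⊤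

/-- `z` is a conditional cluster point of the conditional sequence `x`. -/
def IsClusterPoint (x : CondFun (CondNat A) X) (z : X ⊤) : Prop :=
  ∀ U : CondSubset X, d.topology.IsNhd U z → ∀ n : CondNat A ⊤, ∃ m : CondNat A ⊤,
    CondNat.le n m ∧ x.app ⊤ m ∈ U.sec ⊤

/-- Conditional completeness. -/
def Complete : Prop :=
  ∀ x : CondFun (CondNat A) X, d.IsCauchy x → ∃ z : X ⊤, d.IsLimit x z

/-- Conditional total boundedness. -/
def TotallyBounded : Prop :=
  ∀ ε : CondReal A ⊤, CondReal.Pos ε →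
    ∃ (n : CondNat A ⊤) (x : CondFun (CondNat.segment n) X),
      CondSubset.univ X ≤ CondSubset.sUnion
        (Set.range fun l : CondNat.segment n ⊤ => d.ball (x.app ⊤ l) ε)

/-- Conditional sequential compactness. -/
def SeqCompact : Prop :=
  ∀ x : CondFun (CondNat A) X, ∃ z : X ⊤, d.IsClusterPoint x z

end CondMetric

end Conditional

/-!
A conditional set behaves like a set in the Boolean-valued universe over `A`, and the equivalence
is proved by a classical argument in which truth values in `A` replace propositions.

A conditional predicate on `X` is a function `φ : X ⊤ → A` that depends on its argument only
locally (`CondSet.IsLocal`). Quantifiers become suprema and infima, and gluing along partitions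
gives the maximum principle `CondSet.IsLocal.exists_eq_iSup`: the truth value `⨆ x, φ x` of an
existential statement is attained by some `x`. Proofs by contradiction take place on the condition
`e` on which the claim fails, and show `e = ⊥`.

The notions of the theorem are first reduced to the truth values `d.near k x y` of
`d(x, y) ≤ 2⁻ᵏ` with a classical exponent `k`. This uses that the conditional reals are conditionally
Archimedean (`CondReal.ltVal_eq_iSup`), that a conditional sequence is the same as a classical
sequence of elements of `X` (`exists_condFun_const`), that a conditionally finite family covers iff
locally a classically finite family does (`exists_segment_cover_iff`), and that the open sets of the
generated topology contain with each point locally a ball (`CondMetric.isMetricOpen_of_isOpen`).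

Compactness implies sequential compactness: on the condition where no point is a cluster point,
each point has an open neighborhood which the sequence eventually avoids, and finitely many of these
cannot cover. The neighborhoods must depend conditionally on the point, so the least possible radius
exponent is used (`CondMetric.exists_isOpen_avoiding`). Sequential compactness implies completeness
by the triangle inequality, and total boundedness by picking successively points as far as possible
from the previous ones. For the last implication (`finCoverVal_eq_top`), on the condition where the
space has no finite subcover, total boundedness provides balls of radius `2⁻ᵏ` all of whose finite
intersections have no finite subcover; their centers form a Cauchy sequence, and a member of the
cover around the limit contains one of the balls.
-/

namespace Conditional

/-! ### Truth values and the maximum principle -/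

section Basics

variable {A : Type u} [CompleteBooleanAlgebra A]

/-- A property of conditions that passes to smaller conditions and can be glued along partitions
holds exactly on the conditions below the supremum of those on which it holds. -/
theorem le_sSup_iff_of_local {P : A → Prop} (hmono : ∀ b c, b ≤ c → P c → P b)
    (hglue : ∀ {ι : Type u} (p : ι → A) (a : A), IsPart p a → (∀ i, P (p i)) → P a) {b : A} :
    b ≤ sSup {c | P c} ↔ P b := by
  refine ⟨fun h => hmono _ _ h ?_, fun h => le_sSup h⟩
  obtain ⟨q, hq, hqp⟩ := exists_isPart_le (fun c : {c // P c} => c.1)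
  have e : sSup {c | P c} = ⨆ c : {c // P c}, c.1 := sSup_eq_iSup' _
  rw [e]
  exact hglue q _ hq fun i => hmono _ _ (hqp i) i.2

/-- A partition below a family of conditions, indexed in the universe of the algebra. -/
theorem exists_isPart_comp_le {ι : Type w} (φ : ι → A) :
    ∃ (κ : Type u) (q : κ → A) (f : κ → ι), IsPart q (⨆ i, φ i) ∧ ∀ k, q k ≤ φ (f k) := by
  obtain ⟨q, hq, hqp⟩ := exists_isPart_le (fun c : Set.range φ => c.1)
  rw [← sSup_eq_iSup', sSup_range] at hq
  exact ⟨_, q, fun c => c.2.choose, hq, fun c => (hqp c).trans c.2.choose_spec.ge⟩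

theorem le_of_forall_inf_le {ι : Type w} {p : ι → A} {a c : A} (hp : a ≤ ⨆ i, p i)
    (h : ∀ i, a ⊓ p i ≤ c) : a ≤ c := by
  rw [← inf_eq_left.2 hp, inf_iSup_eq]
  exact iSup_le h

namespace CondSet

variable (X : CondSet.{u, v} A)

instance : Nonempty (X ⊤) :=
  ⟨Function.surjInv (X.surjective ⊥) X.bot_singleton.choose⟩

/-- A family of truth values indexed by `X` that depends on `x` only locally: a conditional
predicate on `X`. -/
def IsLocal (φ : X ⊤ → A) : Prop :=
  ∀ a x y, X.γ a x = X.γ a y → a ⊓ φ x ≤ φ y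

variable {X}

theorem IsLocal.compl {φ : X ⊤ → A} (h : X.IsLocal φ) : X.IsLocal fun x => (φ x)ᶜ := by
  intro a x y e
  rw [le_compl_iff_disjoint_right, disjoint_iff, inf_right_comm, ← le_bot_iff,
    ← inf_compl_eq_bot (a := φ x)]
  exact inf_le_inf_right _ (h a y x e.symm)

/-- The maximum principle: the truth value of an existential statement is attained. -/
theorem IsLocal.exists_eq_iSup {φ : X ⊤ → A} (h : X.IsLocal φ) : ∃ z, φ z = ⨆ x, φ x := by
  obtain ⟨κ, q, f, hq, hqf⟩ := exists_isPart_comp_le φ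
  obtain ⟨y, hy, -⟩ := X.exists_glue hq fun k => X.γ (q k) (f k)
  obtain ⟨z, rfl⟩ := X.surjective _ y
  refine ⟨z, le_antisymm (le_iSup φ z) ?_⟩
  rw [← hq.1]
  refine iSup_le fun k => ?_
  have := h (q k) (f k) z (by rw [← hy k, X.res_γ])
  rwa [inf_eq_left.2 (hqf k)] at this

end CondSet

namespace CondSubset

variable {X : CondSet.{u, v} A}

/-- The truth value of `x ∈ Y`: the largest condition on which `x` belongs to `Y`. -/
def val (Y : CondSubset X) (x : X ⊤) : A := sSup {b | X.γ b x ∈ Y.sec b}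

theorem le_val_iff {Y : CondSubset X} {x : X ⊤} {b : A} : b ≤ Y.val x ↔ X.γ b x ∈ Y.sec b := by
  refine le_sSup_iff_of_local (fun b c h hc => ?_) fun p a hp h => ?_
  · rw [← X.res_γ h]
    exact Y.res_mem h hc
  · refine Y.glue_mem p hp _ fun i => ?_
    rw [X.res_γ]
    exact h i

theorem val_eq_top_iff {Y : CondSubset X} {x : X ⊤} : Y.val x = ⊤ ↔ x ∈ Y.sec ⊤ := by
  rw [← top_le_iff, le_val_iff, X.identity]

theorem isLocal_val (Y : CondSubset X) : X.IsLocal Y.val := by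
  intro a x y e
  have h : X.γ (a ⊓ Y.val x) x ∈ Y.sec _ := le_val_iff.1 inf_le_right
  rw [X.consistency inf_le_left x y e] at h
  exact le_val_iff.2 h

theorem val_mono {Y Z : CondSubset X} (h : Y ≤ Z) (x : X ⊤) : Y.val x ≤ Z.val x :=
  le_val_iff.2 (h _ (le_val_iff.1 le_rfl))

theorem ext_val {Y Z : CondSubset X} (h : ∀ x, Y.val x = Z.val x) : Y = Z := by
  ext a x
  obtain ⟨x, rfl⟩ := X.surjective a x
  rw [← le_val_iff, ← le_val_iff, h]

theorem eq_of_forall_le_iff_val {Y : CondSubset X} {x : X ⊤} {c : A}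
    (h : ∀ b, X.γ b x ∈ Y.sec b ↔ b ≤ c) : Y.val x = c :=
  eq_of_forall_le_iff fun b => le_val_iff.trans (h b)

theorem val_univ (x : X ⊤) : (univ X).val x = ⊤ := val_eq_top_iff.2 trivial

theorem val_empty (x : X ⊤) : (empty X).val x = ⊥ :=
  eq_of_forall_le_iff_val fun _ => le_bot_iff.symm

theorem val_inter (Y Z : CondSubset X) (x : X ⊤) : (inter Y Z).val x = Y.val x ⊓ Z.val x :=
  eq_of_forall_le_iff_val fun b => by
    rw [le_inf_iff, le_val_iff, le_val_iff]; rfl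

theorem val_cut (Y : CondSubset X) (c : A) (x : X ⊤) : (Y.cut c).val x = Y.val x ⊓ c :=
  eq_of_forall_le_iff_val fun b => by
    rw [le_inf_iff, le_val_iff]; rfl

theorem val_sUnion (S : Set (CondSubset X)) (x : X ⊤) :
    (sUnion S).val x = ⨆ Y ∈ S, Y.val x := by
  refine le_antisymm ?_ (iSup₂_le fun Y hY => val_mono ((isLUB_sUnion S).1 hY) x)
  have h₀ : X.γ _ x ∈ (sUnion S).sec ((sUnion S).val x) := le_val_iff.1 le_rfl
  have h : sSup {b | ∃ h : b ≤ (sUnion S).val x, ∃ Y ∈ S, X.res h (X.γ _ x) ∈ Y.sec b} =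
    (sUnion S).val x := h₀
  rw [← h]
  refine sSup_le ?_
  rintro b ⟨hb, Y, hY, hx⟩
  rw [X.res_γ] at hx
  exact le_iSup₂_of_le Y hY (le_val_iff.2 hx)

theorem val_sUnion_range {ι : Type w} (f : ι → CondSubset X) (x : X ⊤) :
    (sUnion (Set.range f)).val x = ⨆ i, (f i).val x := by
  rw [val_sUnion, iSup_range]

theorem univ_le_iff {Y : CondSubset X} : univ X ≤ Y ↔ ∀ x, Y.val x = ⊤ := by
  refine ⟨fun h x => top_le_iff.1 ((val_univ x).ge.trans (val_mono h x)), fun h a x _ => ?_⟩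
  obtain ⟨x, rfl⟩ := X.surjective a x
  exact le_val_iff.1 (le_top.trans (h x).ge)

/-- Two conditional subsets with the same truth values below `a` have the same restriction
to `a`. -/
theorem powerset_γ_eq_iff {a : A} {Y Z : X.powerset ⊤} :
    X.powerset.γ a Y = X.powerset.γ a Z ↔ ∀ x, a ⊓ Y.1.val x = a ⊓ Z.1.val x := by
  refine ⟨fun h x => ?_, fun h => Subtype.ext (ext_val fun x => ?_)⟩
  · have e : Y.1.cut a = Z.1.cut a := congrArg Subtype.val h
    rw [inf_comm, ← val_cut, e, val_cut, inf_comm]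
  · show (Y.1.cut a).val x = (Z.1.cut a).val x
    rw [val_cut, val_cut, inf_comm, h, inf_comm]

end CondSubset

end Basics

/-! ### Truth values for the order of the conditional real numbers -/

section Reals

variable {A : Type u} [CompleteBooleanAlgebra A]

namespace RatSeq

open Gen

/-- The constant sequence `r`. -/
noncomputable def const (A : Type u) [CompleteBooleanAlgebra A] (r : ℚ) : RatSeq A where
  app a _ := (CondRat A).γ a (Gen.const A r)
  natural a _ := by rw [(CondRat A).identity]

theorem val_const_app {b : A} (r : ℚ) (n : CondNat A ⊤) : Val b ((const A r).app ⊤ n) r :=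
  (val_const r).γ le_top

theorem isCauchy_const (r : ℚ) : IsCauchy (const A r) := by
  refine isCauchy_iff.2 fun ε hε => ⟨Gen.const A 1, fun m n _ _ b hb x y t hx hy ht => ?_⟩
  rw [Val.unique hb hx (val_const_app r m), Val.unique hb hy (val_const_app r n), sub_self,
    abs_zero]
  exact pos_iff.1 hε b hb t ht

theorem le_of_val {a : A} {q p : RatSeq A} (h : ∀ n b, b ≠ ⊥ → ∀ r s, Val b (q.app ⊤ n) r →
    Val b (p.app ⊤ n) s → r ≤ s) : Le a q p :=
  le_iff.2 fun ε hε => ⟨Gen.const A 1, fun n _ b hb _ r s t hr hs ht => by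
    have h1 := h n b hb r s hr hs
    have h2 := pos_iff.1 hε b hb t ht
    linarith⟩

theorem equiv_of_le {a : A} {q p : RatSeq A} (h : Le a q p) (h' : Le a p q) : Equiv a q p := by
  refine equiv_iff.2 fun ε hε => ?_
  obtain ⟨n₁, hn₁⟩ := le_iff.1 h ε hε
  obtain ⟨n₂, hn₂⟩ := le_iff.1 h' ε hε
  refine ⟨map₂ max n₁ n₂, fun n hn b hb hba r s t hr hs ht => abs_lt.2 ⟨?_, ?_⟩⟩
  · exact hn₂ n (nat_le_trans (le_max_right _ _) hn) b hb hba s r t hs hr ht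
  · have := hn₁ n (nat_le_trans (le_max_left _ _) hn) b hb hba r s t hr hs ht
    linarith

theorem Le.add {a : A} {q p q' p' : RatSeq A} (h : Le a q p) (h' : Le a q' p') :
    Le a (q.add q') (p.add p') :=
  le_iff.2 (Forced.add (fun r s r' s' t h1 h2 => by linarith) (le_iff.1 h) (le_iff.1 h'))

theorem val_add_of_val {b : A} {q p : RatSeq A} {n : CondNat A ⊤} {r s : ℚ}
    (hq : Val b (q.app ⊤ n) r) (hp : Val b (p.app ⊤ n) s) : Val b ((q.add p).app ⊤ n) (r + s) :=
  hq.map₂ _ hp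

/-- A Cauchy sequence that is not below another one on any part of `b` exceeds it by a fixed
rational number on some part of `b`. -/
theorem exists_const_add_le {q p : RatSeq A} (hq : IsCauchy q) (hp : IsCauchy p) {b : A}
    (h : ¬ Le b p q) : ∃ c ≤ b, c ≠ ⊥ ∧ ∃ k : ℕ, Le c (q.add (const A ((1 / 2) ^ k))) p := by
  rw [le_iff] at h
  unfold Forced at h
  push Not at h
  obtain ⟨ε, hε, h⟩ := h
  obtain ⟨n₁, hn₁⟩ := isCauchy_iff.1 hq _ (pos_half (pos_half hε))
  obtain ⟨n₂, hn₂⟩ := isCauchy_iff.1 hp _ (pos_half (pos_half hε))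
  obtain ⟨n, hn, c, hc, hcb, r, s, t, hr, hs, ht, hrs⟩ := h (map₂ max n₁ n₂)
  have ht0 := pos_iff.1 hε c hc t ht
  obtain ⟨k, hk⟩ := exists_pow_lt_of_lt_one (half_pos ht0) (by norm_num : (1 / 2 : ℚ) < 1)
  refine ⟨c, hcb, hc, k, le_iff.2 fun δ hδ => ⟨map₂ max n₁ n₂, ?_⟩⟩
  intro m hm d hd hdc y x u hy hx hu
  have hu0 := pos_iff.1 hδ d hd u hu
  obtain ⟨e, he, he0, z, hz⟩ := exists_val hd le_top (q.app ⊤ m)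
  have hec := he.trans hdc
  rw [Val.unique he0 (hy.mono he) (val_add_of_val hz (val_const_app _ m))]
  have h1 := abs_lt.1 <| hn₁ n m (nat_le_trans (le_max_left _ _) hn)
    (nat_le_trans (le_max_left _ _) hm) e he0 s z _ (hs.mono hec) hz
    (((ht.mono hec).map fun t : ℚ => t / 2).map fun t : ℚ => t / 2)
  have h2 := abs_lt.1 <| hn₂ n m (nat_le_trans (le_max_right _ _) hn)
    (nat_le_trans (le_max_right _ _) hm) e he0 r x _ (hr.mono hec) (hx.mono he)
    (((ht.mono hec).map fun t : ℚ => t / 2).map fun t : ℚ => t / 2)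
  linarith [h1.1, h1.2, h2.1, h2.2]

theorem eq_bot_of_const_add_le {q : RatSeq A} {a : A} {r : ℚ} (hr : 0 < r)
    (h : Le a (q.add (const A r)) q) : a = ⊥ := by
  by_contra ha
  have hpos : CondRat.Pos (Gen.const A r) := pos_iff.2 fun b hb t ht => by
    rwa [Val.unique hb ht (val_const r)]
  obtain ⟨n₀, hn₀⟩ := le_iff.1 h _ hpos
  obtain ⟨c, hc, hc0, z, hz⟩ := exists_val ha le_top (q.app ⊤ n₀)
  have := hn₀ n₀ (nat_le_refl _) c hc0 hc _ z r (val_add_of_val hz (val_const_app r _)) hz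
    (val_const r)
  linarith

end RatSeq

namespace CondReal

open Gen

/-- The conditional real number given by a rational number. -/
noncomputable def ofRat (A : Type u) [CompleteBooleanAlgebra A] (r : ℚ) : CondReal A ⊤ :=
  Quotient.mk _ ⟨_, RatSeq.isCauchy_const r⟩

theorem le_antisymm {a : A} {x y : CondReal A a} (h : le x y) (h' : le y x) : x = y := by
  induction x using Quotient.inductionOn with
  | _ x =>
    induction y using Quotient.inductionOn with
    | _ y => exact Quotient.sound (RatSeq.equiv_of_le h h')

theorem le_refl {a : A} (x : CondReal A a) : le x x := by
  induction x using Quotient.inductionOn with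
  | _ x => exact (RatSeq.Equiv.refl a x.1).le

theorem add_assoc (x y z : CondReal A ⊤) : add (add x y) z = add x (add y z) := by
  induction x using Quotient.inductionOn with
  | _ x =>
    induction y using Quotient.inductionOn with
    | _ y =>
      induction z using Quotient.inductionOn with
      | _ z =>
        have key : ∀ n b, b ≠ ⊥ → ∀ r s, Val b (((x.1.add y.1).add z.1).app ⊤ n) r →
            Val b ((x.1.add (y.1.add z.1)).app ⊤ n) s → r = s := by
          intro n b hb r s hr hs
          obtain ⟨c, hc, hc0, i, hi⟩ := exists_val hb le_top (x.1.app ⊤ n)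
          obtain ⟨d, hd, hd0, j, hj⟩ := exists_val hc0 le_top (y.1.app ⊤ n)
          obtain ⟨e, he, he0, k, hk⟩ := exists_val hd0 le_top (z.1.app ⊤ n)
          replace hi := hi.mono (he.trans hd)
          replace hj := hj.mono he
          have heb := he.trans (hd.trans hc)
          rw [Val.unique he0 (hr.mono heb)
              (RatSeq.val_add_of_val (RatSeq.val_add_of_val hi hj) hk),
            Val.unique he0 (hs.mono heb)
              (RatSeq.val_add_of_val hi (RatSeq.val_add_of_val hj hk)), _root_.add_assoc]
        exact Quotient.sound (RatSeq.equiv_of_le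
          (RatSeq.le_of_val fun n b hb r s hr hs => (key n b hb r s hr hs).le)
          (RatSeq.le_of_val fun n b hb r s hr hs => (key n b hb s r hs hr).ge))

theorem ofRat_add (r s : ℚ) : add (ofRat A r) (ofRat A s) = ofRat A (r + s) := by
  have key : ∀ n b, b ≠ ⊥ → ∀ x y,
      Val b (((RatSeq.const A r).add (RatSeq.const A s)).app ⊤ n) x →
      Val b ((RatSeq.const A (r + s)).app ⊤ n) y → x = y := fun n b hb x y hx hy =>
    (Val.unique hb hx (RatSeq.val_add_of_val (RatSeq.val_const_app r n)
      (RatSeq.val_const_app s n))).trans (Val.unique hb hy (RatSeq.val_const_app _ n)).symm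
  exact Quotient.sound (RatSeq.equiv_of_le
    (RatSeq.le_of_val fun n b hb r s hr hs => (key n b hb r s hr hs).le)
    (RatSeq.le_of_val fun n b hb r s hr hs => (key n b hb s r hs hr).ge))

theorem ofRat_mono {r s : ℚ} (h : r ≤ s) : le (ofRat A r) (ofRat A s) :=
  RatSeq.le_of_val fun n b hb x y hx hy => by
    rwa [Val.unique hb hx (RatSeq.val_const_app r n), Val.unique hb hy (RatSeq.val_const_app s n)]

/-- The truth value of `x ≤ y`. -/
def leVal (x y : CondReal A ⊤) : A := sSup {b | le ((CondReal A).γ b x) ((CondReal A).γ b y)}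

/-- The truth value of `x < y`. -/
def ltVal (x y : CondReal A ⊤) : A := sSup {b | lt ((CondReal A).γ b x) ((CondReal A).γ b y)}

theorem le_leVal_iff {b : A} {x y : CondReal A ⊤} :
    b ≤ leVal x y ↔ le ((CondReal A).γ b x) ((CondReal A).γ b y) := by
  refine le_sSup_iff_of_local (fun b c h hc => ?_) fun p a hp h => le_glue hp fun i => ?_
  · have := le_res h hc
    rwa [CondSet.res_γ, CondSet.res_γ] at this
  · rw [CondSet.res_γ, CondSet.res_γ]
    exact h i

theorem le_ltVal_iff {b : A} {x y : CondReal A ⊤} :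
    b ≤ ltVal x y ↔ lt ((CondReal A).γ b x) ((CondReal A).γ b y) := by
  refine le_sSup_iff_of_local (fun b c h hc => ?_) fun p a hp h => lt_glue hp fun i => ?_
  · have := lt_res h hc
    rwa [CondSet.res_γ, CondSet.res_γ] at this
  · rw [CondSet.res_γ, CondSet.res_γ]
    exact h i

theorem leVal_eq_top_iff {x y : CondReal A ⊤} : leVal x y = ⊤ ↔ le x y := by
  rw [← top_le_iff, le_leVal_iff, CondSet.identity, CondSet.identity]

theorem ltVal_eq_top_iff {x y : CondReal A ⊤} : ltVal x y = ⊤ ↔ lt x y := by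
  rw [← top_le_iff, le_ltVal_iff, CondSet.identity, CondSet.identity]

theorem leVal_trans (x y z : CondReal A ⊤) : leVal x y ⊓ leVal y z ≤ leVal x z := by
  have h : ∀ b, b ≤ leVal x y → b ≤ leVal y z → b ≤ leVal x z := by
    intro b
    simp only [le_leVal_iff]
    induction x using Quotient.inductionOn with
    | _ x =>
      induction y using Quotient.inductionOn with
      | _ y =>
        induction z using Quotient.inductionOn with
        | _ z => exact RatSeq.Le.trans
  exact h _ inf_le_left inf_le_right

theorem leVal_add (x y x' y' : CondReal A ⊤) :
    leVal x y ⊓ leVal x' y' ≤ leVal (add x x') (add y y') := by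
  have h : ∀ b, b ≤ leVal x y → b ≤ leVal x' y' → b ≤ leVal (add x x') (add y y') := by
    intro b
    simp only [le_leVal_iff]
    induction x using Quotient.inductionOn with
    | _ x =>
      induction y using Quotient.inductionOn with
      | _ y =>
        induction x' using Quotient.inductionOn with
        | _ x' =>
          induction y' using Quotient.inductionOn with
          | _ y' => exact RatSeq.Le.add
  exact h _ inf_le_left inf_le_right

theorem leVal_congr_left {a : A} {x x' y : CondReal A ⊤}
    (h : (CondReal A).γ a x = (CondReal A).γ a x') : a ⊓ leVal x y ≤ leVal x' y := by
  rw [le_leVal_iff, ← (CondReal A).consistency inf_le_left _ _ h, ← le_leVal_iff]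
  exact inf_le_right

theorem leVal_add_pos_le_ltVal {r : ℚ} (hr : 0 < r) (x y : CondReal A ⊤) :
    leVal (add x (ofRat A r)) y ≤ ltVal x y := by
  have h0 : leVal x (add x (ofRat A r)) = ⊤ := by
    refine leVal_eq_top_iff.2 ?_
    induction x using Quotient.inductionOn with
    | _ x =>
      refine RatSeq.le_of_val fun n b hb s t hs ht => ?_
      rw [Val.unique hb ht (RatSeq.val_add_of_val hs (RatSeq.val_const_app r n))]
      linarith
  have h1 : leVal (add x (ofRat A r)) y ≤ leVal x y := by
    have := leVal_trans x (add x (ofRat A r)) y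
    rwa [h0, top_inf_eq] at this
  refine le_ltVal_iff.2 ⟨le_leVal_iff.1 h1, fun b hb e => ?_⟩
  rw [CondSet.res_γ, CondSet.res_γ] at e
  have h2 : b ≤ leVal (add x (ofRat A r)) x := by
    rw [le_leVal_iff, e]
    exact le_leVal_iff.1 hb
  rw [le_leVal_iff] at h2
  clear h0 h1 e hb
  induction x using Quotient.inductionOn with
  | _ x => exact RatSeq.eq_bot_of_const_add_le hr h2

/-- The conditional Archimedean property: where `x < y`, locally `x + 2⁻ᵏ ≤ y` for some
classical `k`. -/
theorem ltVal_eq_iSup (x y : CondReal A ⊤) :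
    ltVal x y = ⨆ k : ℕ, leVal (add x (ofRat A ((1 / 2) ^ k))) y := by
  refine _root_.le_antisymm ?_ (iSup_le fun k => leVal_add_pos_le_ltVal (by positivity) x y)
  by_contra hcon
  set e := ⨆ k : ℕ, leVal (add x (ofRat A ((1 / 2) ^ k))) y
  have hb : ltVal x y ⊓ eᶜ ≠ ⊥ := fun h =>
    hcon (by rwa [← disjoint_iff, ← le_compl_iff_disjoint_right, compl_compl] at h)
  have hlt : lt ((CondReal A).γ _ x) ((CondReal A).γ _ y) :=
    le_ltVal_iff.1 (inf_le_left : ltVal x y ⊓ eᶜ ≤ _)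
  have hnle : ¬ le ((CondReal A).γ (ltVal x y ⊓ eᶜ) y) ((CondReal A).γ _ x) := fun h => by
    refine hb (hlt.2 _ le_rfl ?_)
    rw [le_antisymm hlt.1 h]
  obtain ⟨c, hc, hc0, k, hk⟩ : ∃ c ≤ ltVal x y ⊓ eᶜ, c ≠ ⊥ ∧ ∃ k : ℕ,
      c ≤ leVal (add x (ofRat A ((1 / 2) ^ k))) y := by
    simp only [le_leVal_iff]
    clear_value e
    clear hlt hcon hb
    generalize ltVal x y ⊓ eᶜ = b at hnle ⊢
    induction x using Quotient.inductionOn with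
    | _ x =>
      induction y using Quotient.inductionOn with
      | _ y => exact RatSeq.exists_const_add_le x.2 y.2 hnle
  refine hc0 (le_bot_iff.1 ?_)
  rw [← inf_compl_eq_bot (a := e)]
  exact le_inf (hk.trans (le_iSup (fun k : ℕ => leVal (add x (ofRat A ((1 / 2) ^ k))) y) k))
    (hc.trans inf_le_right)

theorem ltVal_le_leVal (x y : CondReal A ⊤) : ltVal x y ≤ leVal x y :=
  le_leVal_iff.2 (le_ltVal_iff.1 le_rfl).1

theorem zero_add (x : CondReal A ⊤) : add (zero A) x = x := by
  induction x using Quotient.inductionOn with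
  | _ x =>
    have key : ∀ n b, b ≠ ⊥ → ∀ r s, Val b (((RatSeq.zero A).add x.1).app ⊤ n) r →
        Val b (x.1.app ⊤ n) s → r = s := fun n b hb r s hr hs => by
      rw [Val.unique hb hr (RatSeq.val_add_of_val (RatSeq.val_const_app 0 n) hs), _root_.zero_add]
    exact Quotient.sound (RatSeq.equiv_of_le
      (RatSeq.le_of_val fun n b hb r s hr hs => (key n b hb r s hr hs).le)
      (RatSeq.le_of_val fun n b hb r s hr hs => (key n b hb s r hs hr).ge))

/-- A positive conditional real number is locally bounded below by some `2⁻ᵏ`. -/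
theorem Pos.iSup_leVal {ε : CondReal A ⊤} (h : Pos ε) :
    ⨆ k : ℕ, leVal (ofRat A ((1 / 2) ^ k)) ε = ⊤ := by
  have := ltVal_eq_iSup (zero A) ε
  simp only [zero_add] at this
  rw [← this]
  exact ltVal_eq_top_iff.2 h

theorem pos_ofRat {r : ℚ} (hr : 0 < r) : Pos (ofRat A r) := by
  refine ltVal_eq_top_iff.1 (top_le_iff.1 ?_)
  refine le_trans ?_ (leVal_add_pos_le_ltVal hr _ _)
  rw [zero_add, leVal_eq_top_iff.2 (le_refl _)]

end CondReal

end Reals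

/-! ### Conditional sequences and conditionally finite covers -/

section Sequences

variable {A : Type u} [CompleteBooleanAlgebra A]

open Gen

theorem exists_nat_le {φ : ℕ+ → A} (h : ⨆ i, φ i = ⊤) : ∃ n : CondNat A ⊤, ∀ i, n.1 i ≤ φ i := by
  obtain ⟨q, hq, hqp⟩ := exists_isPart_le φ
  exact ⟨⟨q, h ▸ hq⟩, hqp⟩

theorem γ_eq_of_val {E : Type} [Inhabited E] {b : A} {m n : gen A E ⊤} {i : E}
    (hm : Val b m i) (hn : Val b n i) : (gen A E).γ b m = (gen A E).γ b n := by
  have key : ∀ k : gen A E ⊤, Val b k i → ∀ z, b ⊓ k.1 z = ⨆ _ : z = i, b := by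
    intro k hk z
    by_cases hz : z = i
    · subst hz
      rw [iSup_pos rfl]
      exact inf_eq_left.2 hk
    · simp only [hz, iSup_false]
      exact le_bot_iff.1 ((inf_le_inf_right _ hk).trans (k.2.2 i z (Ne.symm hz)).le)
  exact Subtype.ext (funext fun z => (key m hm z).trans (key n hn z).symm)

theorem val_apply {n : CondNat A ⊤} {b : A} {i : ℕ+} (h : b ≤ n.1 i) : Val b n i := h

/-- A statement about conditional natural numbers holds from some conditional index on iff it
holds locally from some classical index on. -/
theorem exists_forall_ge_iff {Φ : CondNat A ⊤ → CondNat A ⊤ → A}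
    (hΦ : ∀ a n n' m m', (CondNat A).γ a n = (CondNat A).γ a n' →
      (CondNat A).γ a m = (CondNat A).γ a m' → a ⊓ Φ n m ≤ Φ n' m') :
    (∃ n₀ : CondNat A ⊤, ∀ n m, CondNat.le n₀ n → CondNat.le n₀ m → Φ n m = ⊤) ↔
      ⨆ N : ℕ+, ⨅ i ≥ N, ⨅ j ≥ N, Φ (const A i) (const A j) = ⊤ := by
  constructor
  · rintro ⟨n₀, hn₀⟩
    rw [← top_le_iff, ← n₀.2.1]
    refine iSup_mono fun N => le_iInf₂ fun i hi => le_iInf₂ fun j hj => ?_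
    have key : ∀ k ≥ N, (CondNat A).γ (n₀.1 N) (map₂ max n₀ (const A k)) =
        (CondNat A).γ (n₀.1 N) (const A k) := fun k hk => by
      refine γ_eq_of_val (i := k) ?_ (val_const k)
      have := Val.map₂ max (val_apply (le_refl (n₀.1 N))) (val_const (A := A) k)
      rwa [max_eq_right hk] at this
    have := hΦ _ _ _ _ _ (key i hi) (key j hj)
    rwa [hn₀ _ _ (le_max_left _ _) (le_max_left _ _), inf_top_eq] at this
  · intro h
    obtain ⟨n₀, hn₀⟩ := exists_nat_le h
    refine ⟨n₀, fun n m hn hm => top_le_iff.1 ?_⟩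
    refine le_of_forall_inf_le n₀.2.1.ge fun N => ?_
    refine le_of_forall_inf_le (le_top.trans n.2.1.ge) fun i => ?_
    refine le_of_forall_inf_le (le_top.trans m.2.1.ge) fun j => ?_
    set b := ⊤ ⊓ n₀.1 N ⊓ n.1 i ⊓ m.1 j
    by_cases hb : b = ⊥
    · rw [hb]
      exact bot_le
    · have h0 : Val b n₀ N := val_apply (inf_le_left.trans (inf_le_left.trans inf_le_right))
      have h1 : Val b n i := val_apply (inf_le_left.trans inf_le_right)
      have h2 : Val b m j := val_apply inf_le_right
      have hi := rel_iff.1 hn b hb N i h0 h1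
      have hj := rel_iff.1 hm b hb N j h0 h2
      have hle : b ≤ Φ (const A i) (const A j) := h0.trans <| (hn₀ N).trans <|
        (iInf₂_le i hi).trans (iInf₂_le j hj)
      have := hΦ b _ _ _ _ (γ_eq_of_val (val_const i) h1) (γ_eq_of_val (val_const j) h2)
      rwa [inf_eq_left.2 hle] at this

/-- A statement about conditional natural numbers holds for arbitrarily large conditional
indices iff it holds locally for arbitrarily large classical indices. -/
theorem forall_exists_ge_iff {Φ : CondNat A ⊤ → A} (hΦ : (CondNat A).IsLocal Φ) :
    (∀ n : CondNat A ⊤, ∃ m, CondNat.le n m ∧ Φ m = ⊤) ↔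
      ∀ N : ℕ+, ⨆ i ≥ N, Φ (const A i) = ⊤ := by
  constructor
  · intro h N
    obtain ⟨m, hm, hm'⟩ := h (const A N)
    rw [← top_le_iff, ← m.2.1]
    refine iSup_le fun i => ?_
    by_cases hb : m.1 i = ⊥
    · rw [hb]
      exact bot_le
    · have hi := rel_iff.1 hm _ hb N i (val_const N) (val_apply le_rfl)
      refine le_iSup₂_of_le i hi ?_
      have := hΦ (m.1 i) m (const A i) (γ_eq_of_val (val_apply le_rfl) (val_const i))
      rwa [hm', inf_top_eq] at this
  · intro h n
    have hφ : ⨆ i : ℕ+, (⨆ N ≤ i, n.1 N) ⊓ Φ (const A i) = ⊤ := by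
      refine top_le_iff.1 (n.2.1.ge.trans (iSup_le fun N => ?_))
      have e : n.1 N = n.1 N ⊓ ⨆ i ≥ N, Φ (const A i) := by rw [h N, inf_top_eq]
      rw [e, inf_iSup₂_eq]
      exact iSup₂_le fun i hi => le_iSup_of_le i (inf_le_inf_right _ (le_iSup₂_of_le N hi le_rfl))
    obtain ⟨m, hm⟩ := exists_nat_le hφ
    refine ⟨m, rel_iff.2 fun b hb N i hN hi => ?_, top_le_iff.1 ?_⟩
    · by_contra hlt
      refine hb (le_bot_iff.1 ?_)
      calc b ≤ n.1 N ⊓ ⨆ N' ≤ i, n.1 N' := le_inf hN (le_trans hi ((hm i).trans inf_le_left))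
        _ ≤ ⊥ := by
          rw [inf_iSup₂_eq]
          exact iSup₂_le fun N' hN' =>
            (n.2.2 N N' fun e => hlt (e ▸ hN')).le
    · rw [← m.2.1]
      refine iSup_le fun i => ?_
      have := hΦ (m.1 i) (const A i) m (γ_eq_of_val (val_const i) (val_apply le_rfl))
      rwa [inf_eq_left.2 ((hm i).trans inf_le_right)] at this

/-- The conditional natural numbers are freely generated: a classical sequence extends to a
conditional one. -/
theorem exists_condFun_const {X : CondSet.{u, v} A} (s : ℕ+ → X ⊤) :
    ∃ f : CondFun (CondNat A) X, ∀ i, f.app ⊤ (const A i) = s i := by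
  have hpart : ∀ n : CondNat A ⊤, IsPart (fun i : ULift.{u} ℕ+ => n.1 i.down) ⊤ := fun n =>
    ⟨(Equiv.ulift.iSup_comp (g := n.1)).trans n.2.1,
      fun i j h => n.2.2 _ _ fun e => h (ULift.ext _ _ e)⟩
  choose f hf using fun n : CondNat A ⊤ =>
    (X.stability _ (hpart n) fun i => X.γ _ (s i.down)).exists
  have hf' : ∀ n (b : A) i, b ≤ n.1 i → X.γ b (f n) = X.γ b (s i) := fun n b i hb =>
    X.consistency hb _ _ (hf n ⟨i⟩)
  refine ⟨CondFun.ofTop f fun a x y h => ?_, fun i => ?_⟩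
  · refine X.ext_cover_top ((hpart x).inf_of_le (le_top : a ≤ ⊤)).1 _ _ fun i => ?_
    rw [hf' x _ i.down inf_le_right]
    have : Val (a ⊓ x.1 i.down) y i.down :=
      Val.congr inf_le_left h (val_apply (n := x) inf_le_right)
    rw [hf' y _ i.down this]
  · rw [CondFun.ofTop_app_top]
    have := hf' (const A i) ⊤ i (val_const i)
    rwa [X.identity, X.identity] at this

theorem min_const_mem_initial (n : CondNat A ⊤) (i : ℕ+) :
    map₂ min (const A i) n ∈ (CondNat.initial n).sec ⊤ := by
  show CondNat.le _ ((CondNat A).γ ⊤ n)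
  rw [CondSet.identity]
  refine rel_iff.2 fun b hb r s hr hs => ?_
  rw [Val.unique hb hr (Val.map₂ min (val_const i) hs)]
  exact min_le_right _ _

/-- The element `min i n` of the segment `{k | 1 ≤ k ≤ n}`, which is `i` on the conditions where
`i ≤ n`. -/
noncomputable def CondNat.segmentMin (n : CondNat A ⊤) (i : ℕ+) : CondNat.segment n ⊤ :=
  ⟨map₂ min (const A i) n, min_const_mem_initial n i⟩

/-- Conditionally finite covers in terms of truth values: locally, a classically finite
subfamily covers. -/
theorem exists_segment_cover_iff {X : CondSet.{u, v} A} {J : CondSet.{u, w} A}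
    {F : J ⊤ → CondSubset X}
    (hF : ∀ y, J.IsLocal fun j => (F j).val y) :
    (∃ (n : CondNat A ⊤) (k : CondFun (CondNat.segment n) J), CondSubset.univ X ≤
        CondSubset.sUnion (Set.range fun l : CondNat.segment n ⊤ => F (k.app ⊤ l))) ↔
      ⨆ S : Finset (J ⊤), ⨅ y, ⨆ j ∈ S, (F j).val y = ⊤ := by
  classical
  simp only [CondSubset.univ_le_iff, CondSubset.val_sUnion_range]
  constructor
  · rintro ⟨n, k, hk⟩
    refine top_le_iff.1 (n.2.1.ge.trans (iSup_le fun N => ?_))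
    let t : ℕ+ → J ⊤ := fun i => k.app ⊤ (CondNat.segmentMin n i)
    refine le_iSup_of_le ((Finset.Icc 1 N).image t) (le_iInf fun y => ?_)
    refine le_of_forall_inf_le (le_top.trans (hk y).ge) fun l => ?_
    refine le_of_forall_inf_le (le_top.trans l.1.2.1.ge) fun i => ?_
    set b := n.1 N ⊓ (F (k.app ⊤ l)).val y ⊓ l.1.1 i
    by_cases hb : b = ⊥
    · rw [hb]
      exact bot_le
    · have hn : Val b n N := val_apply (inf_le_left.trans inf_le_left)
      have hl : Val b l.1 i := val_apply inf_le_right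
      have hmem : CondNat.le l.1 ((CondNat A).γ ⊤ n) := l.2
      rw [CondSet.identity] at hmem
      have hi := rel_iff.1 hmem b hb i N hl hn
      have hmin := Val.map₂ min (val_const (b := b) i) hn
      rw [min_eq_left hi] at hmin
      have e : (CondNat.segment n).γ b l = (CondNat.segment n).γ b (CondNat.segmentMin n i) :=
        Subtype.ext (γ_eq_of_val hl hmin)
      have := hF y b _ _ (k.congr e)
      rw [inf_eq_left.2 (inf_le_left.trans inf_le_right : b ≤ (F (k.app ⊤ l)).val y)] at this
      exact le_iSup₂_of_le (t i)
        (Finset.mem_image_of_mem _ (Finset.mem_Icc.2 ⟨one_le, hi⟩)) this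
  · intro h
    obtain ⟨κ, q, S, hq, hqS⟩ :=
      exists_isPart_comp_le fun S : Finset (J ⊤) => ⨅ y, ⨆ j ∈ S, (F j).val y
    rw [h] at hq
    obtain ⟨j₀⟩ : Nonempty (J ⊤) := inferInstance
    -- On `q c` the cover has length `(S c).card`; the shift by one makes this a positive number.
    obtain ⟨n, hn, -⟩ := (CondNat A).stability q hq
      fun c => (CondNat A).γ (q c) (const A (S c).card.succPNat)
    choose t ht using fun i : ℕ+ =>
      (J.stability q hq fun c => J.γ (q c) ((S c).toList.getD i.natPred j₀)).exists
    obtain ⟨f, hf⟩ := exists_condFun_const t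
    refine ⟨n, ⟨fun a l => f.app a l.1, fun a l => f.natural a l.1⟩, fun y => top_le_iff.1 ?_⟩
    refine hq.1.ge.trans (iSup_le fun c => ?_)
    refine le_of_forall_inf_le (p := fun j : (S c) => (F j.1).val y) ?_ ?_
    · rw [iSup_subtype]
      exact (hqS c).trans (iInf_le _ y)
    · rintro ⟨j, hj⟩
      obtain ⟨i, hi, rfl⟩ := List.getElem_of_mem (Finset.mem_toList.2 hj)
      have hi' : i < (S c).card := by rwa [Finset.length_toList] at hi
      refine le_iSup_of_le (CondNat.segmentMin n i.succPNat) ?_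
      have hnv : Val (q c) n (S c).card.succPNat :=
        Val.congr le_rfl (hn c).symm (val_const _)
      have hmin := Val.map₂ min (val_const (b := q c) i.succPNat) hnv
      rw [min_eq_left (Nat.succPNat_le_succPNat.2 hi'.le)] at hmin
      have e := f.congr (γ_eq_of_val hmin (val_const i.succPNat))
      rw [hf, ht, Nat.natPred_succPNat, List.getD_eq_getElem _ _ hi] at e
      exact hF y (q c) _ _ e.symm

end Sequences

/-! ### Entourages and the topology of a conditional metric space -/

section Metric

variable {A : Type u} [CompleteBooleanAlgebra A] {X : CondSet.{u, v} A}

namespace CondMetric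

open CondReal

variable (d : CondMetric X)

/-- The truth value of `d(x, y) ≤ 2⁻ᵏ`. -/
noncomputable def near (k : ℕ) (x y : X ⊤) : A :=
  leVal (d.dist.app ⊤ (x, y)) (ofRat A ((1 / 2) ^ k))

theorem near_self (k : ℕ) (x : X ⊤) : d.near k x x = ⊤ := by
  refine leVal_eq_top_iff.2 ?_
  rw [(d.eq_zero_iff x x).2 rfl]
  exact ofRat_mono (by positivity)

theorem near_comm (k : ℕ) (x y : X ⊤) : d.near k x y = d.near k y x := by
  rw [near, d.symm, near]

theorem near_antitone {k l : ℕ} (h : k ≤ l) (x y : X ⊤) : d.near l x y ≤ d.near k x y := by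
  have h0 : leVal (ofRat A ((1 / 2) ^ l)) (ofRat A ((1 / 2) ^ k)) = ⊤ :=
    leVal_eq_top_iff.2 (ofRat_mono (pow_le_pow_of_le_one (by norm_num) (by norm_num) h))
  have := leVal_trans (d.dist.app ⊤ (x, y)) (ofRat A ((1 / 2) ^ l)) (ofRat A ((1 / 2) ^ k))
  rwa [h0, inf_top_eq] at this

theorem ofRat_half_add_half (k : ℕ) :
    add (ofRat A ((1 / 2) ^ (k + 1))) (ofRat A ((1 / 2) ^ (k + 1))) = ofRat A ((1 / 2) ^ k) := by
  rw [ofRat_add]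
  congr 1
  rw [pow_succ]
  ring

theorem leVal_triangle (x y z : X ⊤) {r s : CondReal A ⊤} :
    leVal (d.dist.app ⊤ (x, y)) r ⊓ leVal (d.dist.app ⊤ (y, z)) s ≤
      leVal (d.dist.app ⊤ (x, z)) (add r s) := by
  refine (leVal_add _ _ _ _).trans ?_
  have := leVal_trans (d.dist.app ⊤ (x, z)) (add (d.dist.app ⊤ (x, y)) (d.dist.app ⊤ (y, z)))
    (add r s)
  rwa [leVal_eq_top_iff.2 (d.triangle x y z), top_inf_eq] at this

theorem near_trans (k : ℕ) (x y z : X ⊤) :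
    d.near (k + 1) x y ⊓ d.near (k + 1) y z ≤ d.near k x z := by
  have := d.leVal_triangle x y z (r := ofRat A ((1 / 2) ^ (k + 1)))
    (s := ofRat A ((1 / 2) ^ (k + 1)))
  rwa [ofRat_half_add_half] at this

theorem γ_dist_congr {a : A} {x x' y y' : X ⊤} (hx : X.γ a x = X.γ a x')
    (hy : X.γ a y = X.γ a y') :
    (CondReal A).γ a (d.dist.app ⊤ (x, y)) = (CondReal A).γ a (d.dist.app ⊤ (x', y')) :=
  d.dist.congr (X := X.prod X) (x := (x, y)) (y := (x', y')) (Prod.ext hx hy)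

theorem near_congr {a : A} {x x' y y' : X ⊤} (k : ℕ) (hx : X.γ a x = X.γ a x')
    (hy : X.γ a y = X.γ a y') : a ⊓ d.near k x y ≤ d.near k x' y' :=
  leVal_congr_left (d.γ_dist_congr hx hy)

theorem isLocal_near (k : ℕ) (y : X ⊤) : X.IsLocal fun x => d.near k x y :=
  fun _ _ _ h => d.near_congr k h rfl

theorem val_ball (x : X ⊤) (ε : CondReal A ⊤) (y : X ⊤) :
    (d.ball x ε).val y = ltVal (d.dist.app ⊤ (x, y)) ε := by
  refine CondSubset.eq_of_forall_le_iff_val fun b => ?_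
  rw [le_ltVal_iff]
  have e : d.dist.app b (X.γ b x, X.γ b y) = (CondReal A).γ b (d.dist.app ⊤ (x, y)) :=
    d.dist.natural b (x, y)
  rw [← e]
  exact Iff.rfl

theorem val_ball_self {ε : CondReal A ⊤} (hε : Pos ε) (x : X ⊤) : (d.ball x ε).val x = ⊤ := by
  rw [val_ball, (d.eq_zero_iff x x).2 rfl]
  exact ltVal_eq_top_iff.2 hε

theorem val_ball_le_near (k : ℕ) (x y : X ⊤) :
    (d.ball x (ofRat A ((1 / 2) ^ k))).val y ≤ d.near k x y := by
  rw [val_ball]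
  exact ltVal_le_leVal _ _

theorem near_inf_le_val_ball (k : ℕ) (x y : X ⊤) (ε : CondReal A ⊤) :
    d.near (k + 1) x y ⊓ leVal (ofRat A ((1 / 2) ^ k)) ε ≤ (d.ball x ε).val y := by
  rw [val_ball]
  refine le_trans ?_ (leVal_add_pos_le_ltVal (r := (1 / 2) ^ (k + 1)) (by positivity) _ _)
  have h := leVal_add (d.dist.app ⊤ (x, y)) (ofRat A ((1 / 2) ^ (k + 1)))
    (ofRat A ((1 / 2) ^ (k + 1))) (ofRat A ((1 / 2) ^ (k + 1)))
  rw [leVal_eq_top_iff.2 (le_refl _), inf_top_eq, ofRat_half_add_half] at h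
  exact (inf_le_inf_right _ h).trans (leVal_trans _ _ _)

theorem isLocal_val_ball (ε : CondReal A ⊤) (y : X ⊤) :
    X.IsLocal fun x => (d.ball x ε).val y := by
  intro a x x' h
  simp only [val_ball]
  rw [le_ltVal_iff, ← (CondReal A).consistency inf_le_left _ _ (d.γ_dist_congr h rfl),
    ← le_ltVal_iff]
  exact inf_le_right

/-- With every point, `O` contains locally a ball around it. -/
def IsMetricOpen (O : CondSubset X) : Prop :=
  ∀ z, O.val z ≤ ⨆ k, ⨅ y, d.near k z y ⇨ O.val y

theorem isMetricOpen_empty : d.IsMetricOpen (CondSubset.empty X) := fun z => by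
  rw [CondSubset.val_empty]
  exact bot_le

theorem isMetricOpen_univ : d.IsMetricOpen (CondSubset.univ X) := fun z =>
  le_iSup_of_le 0 (le_iInf fun y => by
    rw [CondSubset.val_univ y, himp_top]
    exact le_top)

variable {d}

theorem IsMetricOpen.inter {O O' : CondSubset X} (h : d.IsMetricOpen O)
    (h' : d.IsMetricOpen O') : d.IsMetricOpen (CondSubset.inter O O') := by
  intro z
  have hm : ∀ O : CondSubset X, Monotone fun k => ⨅ y, d.near k z y ⇨ O.val y := fun O k l hkl =>
    iInf_mono fun y => himp_le_himp_right (d.near_antitone hkl z y)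
  rw [CondSubset.val_inter]
  refine (inf_le_inf (h z) (h' z)).trans ?_
  rw [← iSup_inf_of_monotone (hm O) (hm O')]
  refine iSup_mono fun k => ?_
  rw [← iInf_inf_eq]
  refine iInf_mono fun y => ?_
  rw [CondSubset.val_inter, himp_inf_distrib]

theorem IsMetricOpen.sUnion {S : Set (CondSubset X)} (h : ∀ O ∈ S, d.IsMetricOpen O) :
    d.IsMetricOpen (CondSubset.sUnion S) := by
  intro z
  rw [CondSubset.val_sUnion]
  refine iSup₂_le fun O hO => (h O hO z).trans (iSup_mono fun k => iInf_mono fun y => ?_)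
  exact himp_le_himp_left (CondSubset.val_mono ((CondSubset.isLUB_sUnion S).1 hO) y)

theorem IsMetricOpen.cut {O : CondSubset X} (h : d.IsMetricOpen O) (a : A) :
    d.IsMetricOpen (O.cut a) := by
  intro z
  rw [CondSubset.val_cut]
  refine (inf_le_inf_right _ (h z)).trans ?_
  rw [iSup_inf_eq]
  refine iSup_mono fun k => le_iInf fun y => ?_
  rw [CondSubset.val_cut, himp_inf_distrib]
  exact inf_le_inf (iInf_le _ y) le_himp

theorem isMetricOpen_of_isPart {ι : Type u} {p : ι → A} {a : A} (hp : IsPart p a)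
    {O : CondSubset X} (hO : ∀ c, (O.sec c).Nonempty → c ≤ a)
    (h : ∀ i, d.IsMetricOpen (O.cut (p i))) : d.IsMetricOpen O := by
  intro z
  have hle : O.val z ≤ ⨆ i, p i := by
    rw [hp.1]
    exact hO _ ⟨_, CondSubset.le_val_iff.1 le_rfl⟩
  refine le_of_forall_inf_le hle fun i => ?_
  rw [← CondSubset.val_cut]
  refine (h i z).trans (iSup_mono fun k => iInf_mono fun y => himp_le_himp_left ?_)
  rw [CondSubset.val_cut]
  exact inf_le_left

theorem isMetricOpen_ball (x : X ⊤) (ε : CondReal A ⊤) : d.IsMetricOpen (d.ball x ε) := by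
  intro z
  rw [val_ball, ltVal_eq_iSup]
  refine iSup_le fun k => le_iSup_of_le (k + 1) (le_iInf fun y => ?_)
  rw [le_himp_iff, val_ball]
  refine le_trans ?_ (leVal_add_pos_le_ltVal (r := (1 / 2) ^ (k + 1)) (by positivity) _ _)
  -- From `d(x, z) + 2⁻ᵏ ≤ ε` and `d(z, y) ≤ 2⁻⁽ᵏ⁺¹⁾` the triangle inequality leaves the
  -- margin `2⁻⁽ᵏ⁺¹⁾`.
  have h1 : d.near (k + 1) z y ≤ leVal (d.dist.app ⊤ (x, y))
      (add (d.dist.app ⊤ (x, z)) (ofRat A ((1 / 2) ^ (k + 1)))) := by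
    have := d.leVal_triangle x z y (r := d.dist.app ⊤ (x, z))
      (s := ofRat A ((1 / 2) ^ (k + 1)))
    rwa [leVal_eq_top_iff.2 (le_refl _), top_inf_eq] at this
  have h2 := leVal_add (d.dist.app ⊤ (x, y)) (add (d.dist.app ⊤ (x, z))
    (ofRat A ((1 / 2) ^ (k + 1)))) (ofRat A ((1 / 2) ^ (k + 1))) (ofRat A ((1 / 2) ^ (k + 1)))
  rw [leVal_eq_top_iff.2 (le_refl _), inf_top_eq, CondReal.add_assoc, ofRat_half_add_half] at h2
  rw [inf_comm]
  exact (inf_le_inf_right _ (h1.trans h2)).trans (leVal_trans _ _ _)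

theorem powerset_res_coe {a b : A} (h : a ≤ b) (O : X.powerset b) :
    (X.powerset.res h O).1 = O.1.cut a := by
  have e : O = X.powerset.γ b ⟨O.1, fun _ _ => le_top⟩ := Subtype.ext (CondSubset.ext
    (funext fun c => Set.ext fun x => ⟨fun hx => ⟨hx, O.2 c ⟨x, hx⟩⟩, fun hx => hx.1⟩))
  exact congrArg Subtype.val
    ((congrArg (X.powerset.res h) e).trans (X.powerset.res_γ h _))

variable (d)

/-- The metrically open conditional subsets form a conditional topology. -/
def metricTopology : CondTopology X where
  opens :=
    { sec := fun _ => {O | d.IsMetricOpen O.1}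
      res_mem := fun h O hO => by
        show d.IsMetricOpen _
        rw [powerset_res_coe]
        exact IsMetricOpen.cut hO _
      glue_mem := fun p hp O hO => by
        refine isMetricOpen_of_isPart hp O.2 fun i => ?_
        have : d.IsMetricOpen _ := hO i
        rwa [powerset_res_coe] at this }
  empty_mem := d.isMetricOpen_empty
  univ_mem := d.isMetricOpen_univ
  inter_mem _ h _ h' := IsMetricOpen.inter h h'
  sUnion_mem S hS := IsMetricOpen.sUnion (by
    rintro _ ⟨O, hO, rfl⟩
    exact hS hO)

variable {d}

/-- The metrically open sets form one of the topologies containing the balls, hence contain the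
generated one. -/
theorem isMetricOpen_of_isOpen {O : CondSubset X} (h : d.topology.IsOpen O) :
    d.IsMetricOpen O := by
  refine h d.metricTopology ?_
  rintro _ ⟨x, ε, -, rfl⟩
  exact isMetricOpen_ball x ε

theorem isOpen_ball (x : X ⊤) {ε : CondReal A ⊤} (hε : Pos ε) :
    d.topology.IsOpen (d.ball x ε) := fun _ hT => hT _ ⟨x, ε, hε, rfl⟩

theorem isNhd_ball (x : X ⊤) {ε : CondReal A ⊤} (hε : Pos ε) :
    d.topology.IsNhd (d.ball x ε) x :=
  ⟨_, isOpen_ball x hε, CondSubset.val_eq_top_iff.1 (d.val_ball_self hε x), le_rfl⟩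

/-- A conditional neighborhood contains locally a ball. -/
theorem iSup_near_himp_eq_top {U : CondSubset X} {z : X ⊤} (h : d.topology.IsNhd U z) :
    ⨆ k, ⨅ y, d.near k z y ⇨ U.val y = ⊤ := by
  obtain ⟨O, hO, hz, hOU⟩ := h
  refine top_le_iff.1 ((CondSubset.val_eq_top_iff.2 hz).ge.trans
    ((isMetricOpen_of_isOpen hO z).trans ?_))
  exact iSup_mono fun k => iInf_mono fun y => himp_le_himp_left (CondSubset.val_mono hOU y)

end CondMetric

namespace CondTopology

theorem IsOpen.cut {T : CondTopology X} {O : CondSubset X} (h : T.IsOpen O) (a : A) :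
    T.IsOpen (O.cut a) := by
  refine T.opens.glue_mem _ (isPart_compl a) _ ?_
  have key : ∀ (b : A) (U : CondSubset X), T.IsOpen U → (∀ x, b ⊓ (O.cut a).val x = b ⊓ U.val x) →
      X.powerset.res le_top ⟨O.cut a, fun _ _ => le_top⟩ ∈ T.opens.sec b := by
    intro b U hU hb
    have e := (X.powerset.res_top (le_top : b ≤ ⊤) ⟨O.cut a, fun _ _ => le_top⟩).trans
      ((CondSubset.powerset_γ_eq_iff (Z := ⟨U, fun _ _ => le_top⟩).2 hb).trans
        (X.powerset.res_top le_top _).symm)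
    exact (congrArg (· ∈ T.opens.sec b) e).mpr (T.opens.res_mem le_top hU)
  rintro ⟨_ | _⟩
  · refine key aᶜ (CondSubset.empty X) T.empty_mem fun x => ?_
    rw [CondSubset.val_cut, CondSubset.val_empty, inf_left_comm, compl_inf_self]
    simp
  · refine key a O h fun x => ?_
    rw [CondSubset.val_cut, inf_left_comm, inf_idem, inf_comm]

theorem IsOpen.sUnion {T : CondTopology X} {S : Set (CondSubset X)} (h : ∀ O ∈ S, T.IsOpen O) :
    T.IsOpen (CondSubset.sUnion S) := by
  have e : Subtype.val '' {O : X.powerset ⊤ | O.1 ∈ S} = S := Set.ext fun O =>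
    ⟨fun ⟨_, hO, e⟩ => e ▸ hO, fun hO => ⟨⟨O, fun _ _ => le_top⟩, hO, rfl⟩⟩
  rw [← e]
  exact T.sUnion_mem {O | O.1 ∈ S} fun O hO => h O.1 hO

end CondTopology

end Metric

section Characterizations

variable {A : Type u} [CompleteBooleanAlgebra A] {X : CondSet.{u, v} A}

/-! ### The notions of the theorem in terms of truth values -/

theorem le_of_forall₂_inf_le {ι : Type w} {P : ι → Prop} {p : ι → A} {a c : A}
    (hp : a ≤ ⨆ (i) (_ : P i), p i) (h : ∀ i, P i → a ⊓ p i ≤ c) : a ≤ c := by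
  rw [← inf_eq_left.2 hp, inf_iSup₂_eq]
  exact iSup₂_le h

open Gen

/-- The version of `exists_forall_ge_iff` for one conditional natural number. -/
theorem exists_forall_ge_iff' {Φ : CondNat A ⊤ → A} (hΦ : (CondNat A).IsLocal Φ) :
    (∃ n₀ : CondNat A ⊤, ∀ n, CondNat.le n₀ n → Φ n = ⊤) ↔
      ⨆ N : ℕ+, ⨅ i ≥ N, Φ (const A i) = ⊤ := by
  have h := exists_forall_ge_iff (Φ := fun n _ => Φ n) fun a n n' _ _ hn _ => hΦ a n n' hn
  have e : ∀ N : ℕ+, ⨅ i ≥ N, ⨅ j ≥ N, Φ (const A i) = ⨅ i ≥ N, Φ (const A i) := fun N =>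
    iInf_congr fun i => iInf_congr fun _ => biInf_const (s := Set.Ici N) ⟨N, Set.mem_Ici.2 le_rfl⟩
  simp only [e] at h
  rw [← h]
  exact exists_congr fun n₀ => ⟨fun h n m hn _ => h n hn, fun h n hn => h n n hn hn⟩

namespace CondMetric

open CondReal

variable {d : CondMetric X}

theorem isCauchy_iff {x : CondFun (CondNat A) X} : d.IsCauchy x ↔
    ∀ k, ⨆ N : ℕ+, ⨅ i ≥ N, ⨅ j ≥ N,
      d.near k (x.app ⊤ (const A i)) (x.app ⊤ (const A j)) = ⊤ := by
  have h : ∀ ε : CondReal A ⊤, (∃ n₀ : CondNat A ⊤, ∀ n m : CondNat A ⊤, CondNat.le n₀ n →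
      CondNat.le n₀ m → CondReal.le (d.dist.app ⊤ (x.app ⊤ n, x.app ⊤ m)) ε) ↔
      ⨆ N : ℕ+, ⨅ i ≥ N, ⨅ j ≥ N,
        leVal (d.dist.app ⊤ (x.app ⊤ (const A i), x.app ⊤ (const A j))) ε = ⊤ := fun ε => by
    simp only [← leVal_eq_top_iff]
    exact exists_forall_ge_iff
      (Φ := fun n m => leVal (d.dist.app ⊤ (x.app ⊤ n, x.app ⊤ m)) ε)
      fun a n n' m m' hn hm => leVal_congr_left (d.γ_dist_congr (x.congr hn) (x.congr hm))
  refine ⟨fun hx k => (h _).1 (hx _ (pos_ofRat (by positivity))), fun hx ε hε => (h ε).2 ?_⟩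
  refine top_le_iff.1 (le_of_forall_inf_le hε.iSup_leVal.ge fun k => ?_)
  refine le_of_forall_inf_le (le_top.trans (hx k).ge) fun N => le_iSup_of_le N ?_
  refine le_iInf₂ fun i hi => le_iInf₂ fun j hj => ?_
  rw [inf_comm]
  exact (inf_le_inf ((iInf₂_le i hi).trans (iInf₂_le j hj)) inf_le_right).trans
    (leVal_trans _ _ _)

theorem isLocal_val_app (x : CondFun (CondNat A) X) (U : CondSubset X) :
    (CondNat A).IsLocal fun n => U.val (x.app ⊤ n) :=
  fun a _ _ h => U.isLocal_val a _ _ (x.congr h)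

theorem iInf_himp_inf_near_le (k : ℕ) (z y : X ⊤) (φ : X ⊤ → A) :
    (⨅ y, d.near k z y ⇨ φ y) ⊓ d.near k z y ≤ φ y :=
  (inf_le_inf_right _ (iInf_le _ y)).trans himp_inf_le

theorem isLimit_iff {x : CondFun (CondNat A) X} {z : X ⊤} : d.IsLimit x z ↔
    ∀ k, ⨆ N : ℕ+, ⨅ i ≥ N, d.near k z (x.app ⊤ (const A i)) = ⊤ := by
  have h : ∀ U : CondSubset X, (∃ n₀ : CondNat A ⊤, ∀ n : CondNat A ⊤, CondNat.le n₀ n →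
      x.app ⊤ n ∈ U.sec ⊤) ↔ ⨆ N : ℕ+, ⨅ i ≥ N, U.val (x.app ⊤ (const A i)) = ⊤ := fun U => by
    simp only [← CondSubset.val_eq_top_iff]
    exact exists_forall_ge_iff' (isLocal_val_app x U)
  refine ⟨fun hx k => top_le_iff.1 ?_, fun hx U hU => (h U).2 (top_le_iff.1 ?_)⟩
  · refine ((h _).1 (hx _ (isNhd_ball z
      (pos_ofRat (r := (1 / 2) ^ k) (by positivity))))).ge.trans ?_
    exact iSup_mono fun N => iInf₂_mono fun i _ => d.val_ball_le_near k z _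
  · refine le_of_forall_inf_le (iSup_near_himp_eq_top hU).ge fun k => ?_
    refine le_of_forall_inf_le (le_top.trans (hx k).ge) fun N => le_iSup_of_le N ?_
    refine le_iInf₂ fun i hi => ?_
    exact (inf_le_inf inf_le_right (iInf₂_le i hi)).trans (iInf_himp_inf_near_le k z _ U.val)

theorem isClusterPoint_iff {x : CondFun (CondNat A) X} {z : X ⊤} : d.IsClusterPoint x z ↔
    ∀ k, ∀ N : ℕ+, ⨆ i ≥ N, d.near k z (x.app ⊤ (const A i)) = ⊤ := by
  have h : ∀ U : CondSubset X, (∀ n : CondNat A ⊤, ∃ m : CondNat A ⊤, CondNat.le n m ∧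
      x.app ⊤ m ∈ U.sec ⊤) ↔ ∀ N : ℕ+, ⨆ i ≥ N, U.val (x.app ⊤ (const A i)) = ⊤ := fun U => by
    simp only [← CondSubset.val_eq_top_iff]
    exact forall_exists_ge_iff (isLocal_val_app x U)
  refine ⟨fun hx k N => top_le_iff.1 ?_, fun hx U hU => (h U).2 fun N => top_le_iff.1 ?_⟩
  · refine ((h _).1 (hx _ (isNhd_ball z
      (pos_ofRat (r := (1 / 2) ^ k) (by positivity)))) N).ge.trans ?_
    exact iSup₂_mono fun i _ => d.val_ball_le_near k z _
  · refine le_of_forall_inf_le (iSup_near_himp_eq_top hU).ge fun k => ?_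
    refine le_of_forall₂_inf_le (le_top.trans (hx k N).ge) fun i hi => le_iSup₂_of_le i hi ?_
    exact (inf_le_inf_right _ inf_le_right).trans (iInf_himp_inf_near_le k z _ U.val)

theorem totallyBounded_iff : d.TotallyBounded ↔
    ∀ k, ⨆ S : Finset (X ⊤), ⨅ y, ⨆ x ∈ S, d.near k x y = ⊤ := by
  have h : ∀ ε, _ := fun ε => exists_segment_cover_iff (F := fun x => d.ball x ε)
    (d.isLocal_val_ball ε)
  refine ⟨fun hd k => top_le_iff.1 ?_, fun hd ε hε => (h ε).2 (top_le_iff.1 ?_)⟩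
  · refine ((h _).1 (hd _ (pos_ofRat (r := (1 / 2) ^ k) (by positivity)))).ge.trans ?_
    exact iSup_mono fun S => iInf_mono fun y => iSup₂_mono fun x _ => d.val_ball_le_near k x y
  · refine le_of_forall_inf_le hε.iSup_leVal.ge fun k => ?_
    refine le_of_forall_inf_le (le_top.trans (hd (k + 1)).ge) fun S => ?_
    refine le_iSup_of_le S (le_iInf fun y => ?_)
    refine le_of_forall₂_inf_le (inf_le_right.trans (iInf_le _ y)) fun x hx => ?_
    refine le_iSup₂_of_le x hx (le_trans ?_ (d.near_inf_le_val_ball k x y ε))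
    exact le_inf inf_le_right (inf_le_left.trans (inf_le_left.trans inf_le_right))

theorem isLocal_val_condFun {J : CondSet.{u, w} A} (O : CondFun J X.powerset) (y : X ⊤) :
    J.IsLocal fun j => (O.app ⊤ j).1.val y := fun a i j h => by
  rw [CondSubset.powerset_γ_eq_iff.1 (O.congr h) y]
  exact inf_le_right

theorem compact_iff : d.Compact ↔ ∀ (J : CondSet.{u, max u v} A) (O : CondFun J X.powerset),
    (∀ j, d.topology.IsOpen (O.app ⊤ j).1) → (∀ y, ⨆ j, (O.app ⊤ j).1.val y = ⊤) →
    ⨆ S : Finset (J ⊤), ⨅ y, ⨆ j ∈ S, (O.app ⊤ j).1.val y = ⊤ := by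
  refine forall₂_congr fun J O => imp_congr_right fun _ => imp_congr ?_ ?_
  · simp only [CondSubset.univ_le_iff, CondSubset.val_sUnion_range]
  · exact exists_segment_cover_iff (F := fun j => (O.app ⊤ j).1) (isLocal_val_condFun O)

end CondMetric

end Characterizations

section Equivalences

variable {A : Type u} [CompleteBooleanAlgebra A] {X : CondSet.{u, v} A} {d : CondMetric X}

open Gen

/-! ### Sequential compactness implies completeness and total boundedness -/

namespace CondMetric

theorem SeqCompact.complete (h : d.SeqCompact) : d.Complete := by
  intro x hx
  obtain ⟨z, hz⟩ := h x
  rw [isCauchy_iff] at hx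
  rw [isClusterPoint_iff] at hz
  refine ⟨z, isLimit_iff.2 fun k => top_le_iff.1 ?_⟩
  refine (hx (k + 1)).ge.trans ?_
  refine iSup_mono fun N => le_iInf₂ fun i hi => ?_
  refine le_of_forall₂_inf_le (le_top.trans (hz (k + 1) N).ge) fun j hj => ?_
  refine le_trans ?_ (d.near_trans k z (x.app ⊤ (const A j)) _)
  refine le_inf inf_le_right (inf_le_left.trans ?_)
  rw [near_comm]
  exact (iInf₂_le i hi).trans (iInf₂_le j hj)

theorem SeqCompact.totallyBounded (h : d.SeqCompact) : d.TotallyBounded := by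
  classical
  refine totallyBounded_iff.2 fun k => ?_
  -- `pick S` is as far from the finite set `S` as possible, by the maximum principle.
  have hloc : ∀ S : Finset (X ⊤), X.IsLocal fun y => (⨆ x ∈ S, d.near k x y)ᶜ := fun S =>
    CondSet.IsLocal.compl fun a y y' e => by
      rw [inf_iSup₂_eq]
      exact iSup₂_mono fun x _ => d.near_congr k rfl e
  choose pick hpick using fun S => (hloc S).exists_eq_iSup
  let S : ℕ → Finset (X ⊤) := fun n => Nat.rec ∅ (fun _ T => insert (pick T) T) n
  have hS : ∀ n, S (n + 1) = insert (pick (S n)) (S n) := fun n => rfl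
  have hmono : Monotone S := monotone_nat_of_le_succ fun n => by
    rw [hS]
    exact Finset.subset_insert _ _
  obtain ⟨f, hf⟩ := exists_condFun_const fun i : ℕ+ => pick (S i)
  obtain ⟨z, hz⟩ := h f
  rw [isClusterPoint_iff] at hz
  simp only [hf] at hz
  have key : (⨆ T : Finset (X ⊤), ⨅ y, ⨆ x ∈ T, d.near k x y)ᶜ = ⊥ := by
    set e := (⨆ T : Finset (X ⊤), ⨅ y, ⨆ x ∈ T, d.near k x y)ᶜ
    have he : ∀ n, e ≤ (⨆ x ∈ S n, d.near k x (pick (S n)))ᶜ := fun n => by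
      rw [hpick (S n), ← compl_iInf]
      exact compl_le_compl (le_iSup (fun T : Finset (X ⊤) => ⨅ y, ⨆ x ∈ T, d.near k x y) (S n))
    refine le_bot_iff.1 (le_of_forall₂_inf_le (le_top.trans (hz (k + 1) 1).ge) fun i _ => ?_)
    refine le_of_forall₂_inf_le (le_top.trans (hz (k + 1) (i + 1)).ge) fun j hj => ?_
    have hmem : pick (S i) ∈ S j :=
      hmono (PNat.coe_le_coe _ _ |>.2 hj) (hS i ▸ Finset.mem_insert_self _ _)
    have h1 : d.near (k + 1) z (pick (S i)) ⊓ d.near (k + 1) z (pick (S j)) ≤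
        ⨆ x ∈ S j, d.near k x (pick (S j)) := by
      refine le_iSup₂_of_le _ hmem ?_
      rw [d.near_comm (k + 1) z (pick (S i))]
      exact d.near_trans k _ _ _
    rw [← inf_compl_eq_bot (a := ⨆ x ∈ S j, d.near k x (pick (S j)))]
    exact le_inf ((inf_le_inf_right _ inf_le_right).trans h1)
      (inf_le_left.trans (inf_le_left.trans (he j)))
  exact compl_eq_bot.1 key

end CondMetric

/-! ### Completeness and total boundedness imply compactness -/

/-- The truth value of the statement that finitely many of the `O j` cover `G`. -/
def finCoverVal {ι : Type w} (O : ι → X ⊤ → A) (G : X ⊤ → A) : A :=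
  ⨆ S : Finset ι, ⨅ y, G y ⇨ ⨆ j ∈ S, O j y

section FinCover

variable {ι : Type w} {O : ι → X ⊤ → A}

theorem inf_finCoverVal_le {a : A} {G H : X ⊤ → A} (h : ∀ y, a ⊓ G y ≤ H y) :
    a ⊓ finCoverVal O H ≤ finCoverVal O G := by
  rw [finCoverVal, inf_iSup_eq]
  refine iSup_mono fun S => le_iInf fun y => ?_
  rw [le_himp_iff, inf_right_comm]
  exact (inf_le_inf (h y) (iInf_le _ y)).trans inf_himp_le

theorem finCoverVal_sup (G H : X ⊤ → A) :
    finCoverVal O G ⊓ finCoverVal O H ≤ finCoverVal O (G ⊔ H) := by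
  classical
  rw [finCoverVal, finCoverVal, iSup_inf_eq]
  refine iSup_le fun S => ?_
  rw [inf_iSup_eq]
  refine iSup_le fun T => le_iSup_of_le (S ∪ T) (le_iInf fun y => ?_)
  have hS : ⨆ j ∈ S, O j y ≤ ⨆ j ∈ S ∪ T, O j y :=
    biSup_mono fun j hj => Finset.mem_union_left _ hj
  have hT : ⨆ j ∈ T, O j y ≤ ⨆ j ∈ S ∪ T, O j y :=
    biSup_mono fun j hj => Finset.mem_union_right _ hj
  rw [Pi.sup_apply, sup_himp_distrib]
  exact inf_le_inf ((iInf_le _ y).trans (himp_le_himp_left hS))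
    ((iInf_le _ y).trans (himp_le_himp_left hT))

theorem finCoverVal_compl_le (G : X ⊤ → A) : (finCoverVal O G)ᶜ ≤ ⨆ y, G y := by
  rw [← compl_le_compl_iff_le, compl_compl, compl_iSup]
  refine le_iSup_of_le ∅ (iInf_mono fun y => ?_)
  simp

theorem finCoverVal_biSup {κ : Type*} (T : Finset κ) (G : κ → X ⊤ → A) :
    ⨅ x ∈ T, finCoverVal O (G x) ≤ finCoverVal O (⨆ x ∈ T, G x) := by
  classical
  induction T using Finset.induction_on with
  | empty =>
    refine le_iSup_of_le ∅ (le_iInf fun y => ?_)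
    simp
  | insert x T hx ih =>
    rw [Finset.iInf_insert, Finset.iSup_insert]
    exact (inf_le_inf_left _ ih).trans (finCoverVal_sup _ _)

/-- In a totally bounded space a set without finite subcover meets some ball of radius `2⁻ᵏ` in
a set without finite subcover. -/
theorem exists_near_finCoverVal_compl (hd : d.TotallyBounded) (W : X ⊤ → A) (k : ℕ) :
    ∃ x, (finCoverVal O W)ᶜ ≤ (finCoverVal O (W ⊓ d.near k x))ᶜ := by
  have hloc : X.IsLocal fun x => (finCoverVal O (W ⊓ d.near k x))ᶜ :=
    CondSet.IsLocal.compl fun a x x' e => inf_finCoverVal_le fun y => by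
      rw [Pi.inf_apply, Pi.inf_apply, inf_left_comm]
      exact inf_le_inf_left _ (d.near_congr k e.symm rfl)
  obtain ⟨x, hx⟩ := hloc.exists_eq_iSup
  refine ⟨x, ?_⟩
  rw [hx, ← compl_iInf]
  refine compl_le_compl ?_
  refine le_of_forall_inf_le (le_top.trans (CondMetric.totallyBounded_iff.1 hd k).ge) fun T => ?_
  have h1 : ⨅ x, finCoverVal O (W ⊓ d.near k x) ≤
      finCoverVal O (⨆ x ∈ T, W ⊓ d.near k x) :=
    (le_iInf₂ fun x _ => iInf_le _ x).trans (finCoverVal_biSup T _)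
  rw [inf_comm]
  refine (inf_le_inf_left _ h1).trans (inf_finCoverVal_le fun y => ?_)
  rw [inf_comm]
  refine (inf_le_inf_left _ (iInf_le _ y)).trans ?_
  rw [inf_iSup₂_eq]
  simp [iSup_apply]

/-- Heine–Borel for truth values: in a complete and totally bounded space, a cover by open sets
has locally a finite subcover. -/
theorem finCoverVal_eq_top (hc : d.Complete) (hd : d.TotallyBounded)
    (hcov : ∀ z, ⨆ j, O j z = ⊤) (hopen : ∀ j z, O j z ≤ ⨆ k, ⨅ y, d.near k z y ⇨ O j y) :
    finCoverVal O ⊤ = ⊤ := by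
  choose pick hpick using fun W k => exists_near_finCoverVal_compl (O := O) hd W k
  set e := (finCoverVal O ⊤)ᶜ with he
  -- On `e`, the intersection `W m` of the first `m` balls is never finitely covered.
  let W : ℕ → X ⊤ → A := fun n => Nat.rec ⊤ (fun k V => V ⊓ d.near k (pick V k)) n
  let t : ℕ → X ⊤ := fun k => pick (W k) k
  have hW : ∀ k, W (k + 1) = W k ⊓ d.near k (t k) := fun k => rfl
  have heW : ∀ k, e ≤ (finCoverVal O (W k))ᶜ := fun k => by
    induction k with
    | zero => exact le_rfl
    | succ k ih => exact ih.trans (hpick (W k) k)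
  have hanti : Antitone W := antitone_nat_of_succ_le fun n => inf_le_left
  have hnear : ∀ {k m : ℕ} (y), k < m → W m y ≤ d.near k (t k) y := fun y hkm =>
    (hanti (Nat.succ_le_of_lt hkm) y).trans inf_le_right
  have hcauchy : ∀ k i j, k < i → k < j → e ≤ d.near k (t i) (t j) := by
    intro k i j hi hj
    refine (heW (max i j + 1)).trans ((finCoverVal_compl_le _).trans (iSup_le fun y => ?_))
    refine le_trans (le_inf ?_ ?_) (d.near_trans k (t i) y (t j))
    · exact (hnear y (Nat.lt_succ_of_le (le_max_left i j))).trans (d.near_antitone hi _ _)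
    · rw [d.near_comm]
      exact (hnear y (Nat.lt_succ_of_le (le_max_right i j))).trans (d.near_antitone hj _ _)
  -- Off `e` the sequence is replaced by a constant one, so that it is Cauchy everywhere.
  obtain ⟨x₀⟩ : Nonempty (X ⊤) := inferInstance
  choose s hs hs' using fun i => X.exists_pair e (X.γ e (t i)) (X.γ eᶜ x₀)
  obtain ⟨f, hf⟩ := exists_condFun_const fun i : ℕ+ => s i
  have hfc : d.IsCauchy f := by
    refine CondMetric.isCauchy_iff.2 fun k => top_le_iff.1 ?_
    simp only [hf]
    refine le_iSup_of_le k.succPNat (le_iInf₂ fun i hi => le_iInf₂ fun j hj => ?_)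
    have hi' : k < (i : ℕ) := hi
    have hj' : k < (j : ℕ) := hj
    refine (sup_compl_eq_top (x := e)).ge.trans (sup_le ?_ ?_)
    · have := d.near_congr k (hs i).symm (hs j).symm
      rwa [inf_eq_left.2 (hcauchy k i j hi' hj')] at this
    · have := d.near_congr k (hs' i).symm (hs' j).symm
      rwa [d.near_self, inf_top_eq] at this
  obtain ⟨z, hz⟩ := hc f hfc
  rw [CondMetric.isLimit_iff] at hz
  simp only [hf] at hz
  refine compl_eq_bot.1 (le_bot_iff.1 ?_)
  rw [← he]
  refine le_of_forall_inf_le (le_top.trans (hcov z).ge) fun j => ?_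
  refine le_of_forall_inf_le (inf_le_right.trans (hopen j z)) fun k => ?_
  refine le_of_forall_inf_le (le_top.trans (hz (k + 1)).ge) fun N => ?_
  set c := ⨅ y, d.near k z y ⇨ O j y
  set b := e ⊓ O j z ⊓ c ⊓ ⨅ i ≥ N, d.near (k + 1) z (s i)
  have hbe : b ≤ e := inf_le_left.trans (inf_le_left.trans inf_le_left)
  have hbc : b ≤ c := inf_le_left.trans inf_le_right
  -- Far out in the sequence the ball around `t i` lies in the ball around `z`, hence in `O j`.
  let i : ℕ+ := max N k.succPNat
  have hki : k + 1 ≤ (i : ℕ) := PNat.coe_le_coe _ _ |>.2 (le_max_right N k.succPNat)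
  have hbz : b ≤ d.near (k + 1) z (t i) := by
    have h1 : b ≤ d.near (k + 1) z (s i) := inf_le_right.trans (iInf₂_le i (le_max_left _ _))
    have h2 := d.near_congr (k + 1) (a := e) (x := z) rfl (hs i)
    exact (le_inf hbe h1).trans h2
  have hcov' : b ≤ finCoverVal O (W (i + 1)) := by
    refine le_iSup_of_le {j} (le_iInf fun y => ?_)
    rw [le_himp_iff, Finset.iSup_singleton]
    have h1 : b ⊓ W (i + 1) y ≤ d.near k z y :=
      (inf_le_inf hbz ((hnear y (Nat.lt_succ_self _)).trans (d.near_antitone hki _ _))).trans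
        (d.near_trans k z (t i) y)
    exact (le_inf (inf_le_left.trans hbc) h1).trans
      (CondMetric.iInf_himp_inf_near_le k z y (O j))
  rw [← inf_compl_eq_bot (a := finCoverVal O (W (i + 1)))]
  exact le_inf hcov' (hbe.trans (heW ((i : ℕ) + 1)))

end FinCover

theorem CondMetric.compact_of_complete (hc : d.Complete) (hd : d.TotallyBounded) :
    d.Compact := by
  refine compact_iff.2 fun J O hO hcov => ?_
  have := finCoverVal_eq_top (O := fun j : J ⊤ => (O.app ⊤ j).1.val) hc hd hcov
    fun j => isMetricOpen_of_isOpen (hO j)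
  simpa [finCoverVal] using this

/-! ### Compactness implies sequential compactness -/

theorem CondSet.IsLocal.iSup {ι : Sort*} {φ : ι → X ⊤ → A} (h : ∀ i, X.IsLocal (φ i)) :
    X.IsLocal fun x => ⨆ i, φ i x := fun a x y e => by
  rw [inf_iSup_eq]
  exact iSup_mono fun i => h i a x y e

theorem CondSet.IsLocal.iInf {ι : Sort*} {φ : ι → X ⊤ → A} (h : ∀ i, X.IsLocal (φ i)) :
    X.IsLocal fun x => ⨅ i, φ i x := fun a x y e =>
  le_iInf fun i => (inf_le_inf_left _ (iInf_le _ i)).trans (h i a x y e)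

theorem CondSet.IsLocal.inf {φ ψ : X ⊤ → A} (h : X.IsLocal φ) (h' : X.IsLocal ψ) :
    X.IsLocal fun x => φ x ⊓ ψ x := fun a x y e =>
  le_inf ((inf_le_inf_left _ inf_le_left).trans (h a x y e))
    ((inf_le_inf_left _ inf_le_right).trans (h' a x y e))

theorem CondSet.IsLocal.sup_const {φ : X ⊤ → A} (h : X.IsLocal φ) (c : A) :
    X.IsLocal fun x => φ x ⊔ c := fun a x y e => by
  rw [inf_sup_left]
  exact sup_le_sup (h a x y e) inf_le_right

theorem CondSet.IsLocal.inf_eq {φ : X ⊤ → A} (h : X.IsLocal φ) {a : A} {x y : X ⊤}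
    (e : X.γ a x = X.γ a y) : a ⊓ φ x = a ⊓ φ y :=
  le_antisymm (le_inf inf_le_left (h a x y e)) (le_inf inf_le_left (h a y x e.symm))

theorem iSup_iInf_ge_inf_le (P Q : ℕ+ → A) :
    (⨆ N : ℕ+, ⨅ i ≥ N, P i) ⊓ (⨆ N : ℕ+, ⨅ i ≥ N, Q i) ≤ ⨆ N : ℕ+, ⨅ i ≥ N, P i ⊓ Q i := by
  have hm : ∀ P : ℕ+ → A, Monotone fun N : ℕ+ => ⨅ i ≥ N, P i := fun P M N h =>
    biInf_mono fun i hi => h.trans hi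
  rw [← iSup_inf_of_monotone (hm P) (hm Q)]
  refine iSup_mono fun N => le_iInf₂ fun i hi => ?_
  exact inf_le_inf (iInf₂_le i hi) (iInf₂_le i hi)

namespace CondMetric

/-- In a compact space, a conditional assignment of an open set to each of its points has locally
a finite subcover. -/
theorem Compact.iSup_finset_eq_top (h : d.Compact) {B : X ⊤ → CondSubset X}
    (hB_local : ∀ y, X.IsLocal fun z => (B z).val y) (hB_open : ∀ z, d.topology.IsOpen (B z))
    (hB_self : ∀ z, (B z).val z = ⊤) :
    ⨆ S : Finset (X ⊤), ⨅ y, ⨆ z ∈ S, (B z).val y = ⊤ := by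
  classical
  -- The second factor of the index set only adjusts its universe.
  let O : CondFun (X.prod (CondNat A)) X.powerset :=
    CondFun.ofTop (fun p => ⟨B p.1, fun _ _ => le_top⟩) fun a p q hpq =>
      CondSubset.powerset_γ_eq_iff.2 fun y => (hB_local y).inf_eq (congrArg Prod.fst hpq)
  have hO : ∀ p, (O.app ⊤ p).1 = B p.1 := fun p =>
    congrArg (fun Y : X.powerset ⊤ => Y.1) (CondFun.ofTop_app_top _ _ p)
  have hfin := compact_iff.1 h _ O (fun p => (hO p).symm ▸ hB_open p.1) fun y => top_le_iff.1 <|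
    le_iSup_of_le (y, const A 1)
      ((hB_self y).ge.trans (CondSubset.val_mono (hO (y, const A 1)).ge y))
  refine top_le_iff.1 (hfin.ge.trans (iSup_le fun S => ?_))
  refine le_iSup_of_le (S.image Prod.fst) (iInf_mono fun y => iSup₂_le fun p hp => ?_)
  exact le_iSup₂_of_le p.1 (Finset.mem_image_of_mem _ hp) (CondSubset.val_mono (hO p).le y)

/-- If on `e` no point is a cluster point of `s`, then every point has, conditionally, an open
neighborhood that `s` eventually avoids on `e`. -/
theorem exists_isOpen_avoiding {s : ℕ+ → X ⊤} {e : A}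
    (he : ∀ z, e ≤ ⨆ k, ⨆ N : ℕ+, ⨅ i ≥ N, (d.near k z (s i))ᶜ) :
    ∃ B : X ⊤ → CondSubset X, (∀ y, X.IsLocal fun z => (B z).val y) ∧
      (∀ z, d.topology.IsOpen (B z)) ∧ (∀ z, (B z).val z = ⊤) ∧
      ∀ z, e ≤ ⨆ N : ℕ+, ⨅ i ≥ N, ((B z).val (s i))ᶜ := by
  -- `t k z`: on `e`, the sequence is eventually outside the ball of radius `2⁻ᵏ` around `z`.
  let t : ℕ → X ⊤ → A := fun k z => (⨆ N : ℕ+, ⨅ i ≥ N, (d.near k z (s i))ᶜ) ⊔ eᶜ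
  have ht : ∀ k, X.IsLocal (t k) := fun k => CondSet.IsLocal.sup_const
    (CondSet.IsLocal.iSup fun N => CondSet.IsLocal.iInf fun i => CondSet.IsLocal.iInf fun _ =>
      (d.isLocal_near k (s i)).compl) _
  have ht_top : ∀ z, ⨆ k, t k z = ⊤ := fun z => by
    rw [← iSup_sup]
    exact top_le_iff.1 ((sup_compl_eq_top (x := e)).ge.trans (sup_le_sup_right (he z) _))
  -- `D k z`: `k` is the least index for which `t k z` holds.
  let D : ℕ → X ⊤ → A := fun k z => disjointed (fun k => t k z) k
  have hD : ∀ k, X.IsLocal (D k) := fun k => by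
    have e : D k = fun z => t k z ⊓ ⨅ j, ⨅ _ : j < k, (t j z)ᶜ :=
      funext fun z => disjointed_eq_inf_compl _ k
    rw [e]
    exact (ht k).inf (CondSet.IsLocal.iInf fun j => CondSet.IsLocal.iInf fun _ => (ht j).compl)
  have hD_top : ∀ z, ⨆ k, D k z = ⊤ := fun z => (iSup_disjointed _).trans (ht_top z)
  have hD_disj : ∀ z k l, k ≠ l → Disjoint (D k z) (D l z) := fun z k l hkl =>
    disjoint_disjointed (fun k => t k z) hkl
  have hDt : ∀ k z, e ⊓ D k z ≤ ⨆ N : ℕ+, ⨅ i ≥ N, (d.near k z (s i))ᶜ := fun k z => by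
    refine (inf_le_inf_left e (disjointed_le (fun k => t k z) k)).trans ?_
    show e ⊓ (_ ⊔ eᶜ) ≤ _
    rw [inf_sup_left, inf_compl_eq_bot, sup_bot_eq]
    exact inf_le_right
  clear_value D
  have hpos : ∀ k : ℕ, CondReal.Pos (CondReal.ofRat A ((1 / 2) ^ k)) := fun k =>
    CondReal.pos_ofRat (by positivity)
  have hB : ∀ z y, (CondSubset.sUnion
      (Set.range fun k => (d.ball z (CondReal.ofRat A ((1 / 2) ^ k))).cut (D k z))).val y =
      ⨆ k, (d.ball z (CondReal.ofRat A ((1 / 2) ^ k))).val y ⊓ D k z := fun z y => by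
    rw [CondSubset.val_sUnion_range]
    exact iSup_congr fun k => CondSubset.val_cut _ _ _
  refine ⟨fun z => CondSubset.sUnion
    (Set.range fun k => (d.ball z (CondReal.ofRat A ((1 / 2) ^ k))).cut (D k z)),
    fun y => ?_, fun z => ?_, fun z => ?_, fun z => ?_⟩
  · simp only [hB]
    exact CondSet.IsLocal.iSup fun k => (d.isLocal_val_ball _ y).inf (hD k)
  · refine CondTopology.IsOpen.sUnion ?_
    rintro _ ⟨k, rfl⟩
    exact (isOpen_ball z (hpos k)).cut _
  · rw [hB]
    refine top_le_iff.1 ((hD_top z).ge.trans (iSup_mono fun k => ?_))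
    rw [val_ball_self _ (hpos k), top_inf_eq]
  · refine le_of_forall_inf_le (le_top.trans (hD_top z).ge) fun k => ?_
    refine le_of_forall_inf_le (hDt k z) fun N => le_iSup_of_le N (le_iInf₂ fun i hi => ?_)
    rw [hB, compl_iSup]
    refine le_iInf fun l => ?_
    rw [le_compl_iff_disjoint_right]
    by_cases hkl : k = l
    · subst hkl
      exact Disjoint.mono (inf_le_right.trans (iInf₂_le i hi))
        (inf_le_left.trans (d.val_ball_le_near k z (s i))) disjoint_compl_left
    · exact Disjoint.mono (inf_le_left.trans inf_le_right) inf_le_right (hD_disj z k l hkl)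

theorem Compact.seqCompact (h : d.Compact) : d.SeqCompact := by
  classical
  intro x
  let s : ℕ+ → X ⊤ := fun i => x.app ⊤ (const A i)
  let K : X ⊤ → A := fun z => ⨅ k, ⨅ N : ℕ+, ⨆ i ≥ N, d.near k z (s i)
  have hK : X.IsLocal K := CondSet.IsLocal.iInf fun k => CondSet.IsLocal.iInf fun N =>
    CondSet.IsLocal.iSup fun i => CondSet.IsLocal.iSup fun _ => d.isLocal_near k (s i)
  -- By the maximum principle, off `K z₀` no point at all is a cluster point.
  obtain ⟨z₀, hz₀⟩ := hK.exists_eq_iSup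
  suffices he : (K z₀)ᶜ = ⊥ by
    refine ⟨z₀, isClusterPoint_iff.2 fun k N => top_le_iff.1 ?_⟩
    exact (compl_eq_bot.1 he).ge.trans ((iInf_le _ k).trans (iInf_le _ N))
  obtain ⟨B, hB_local, hB_open, hB_self, havoid⟩ :=
    exists_isOpen_avoiding (d := d) (s := s) (e := (K z₀)ᶜ) fun z => by
      refine (compl_le_compl (hz₀ ▸ le_iSup K z : K z ≤ K z₀)).trans (le_of_eq ?_)
      simp only [K, compl_iInf, compl_iSup]
  generalize (K z₀)ᶜ = e at havoid ⊢
  have havoid_fin : ∀ S : Finset (X ⊤),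
      e ≤ ⨆ N : ℕ+, ⨅ i ≥ N, (⨆ z ∈ S, (B z).val (s i))ᶜ := fun S => by
    induction S using Finset.induction_on with
    | empty => exact le_iSup_of_le 1 (le_iInf₂ fun i _ => by simp)
    | insert z S hz ih =>
      simp only [Finset.iSup_insert, compl_sup]
      exact (le_inf (havoid z) ih).trans (iSup_iInf_ge_inf_le _ _)
  have hfin := h.iSup_finset_eq_top hB_local hB_open hB_self
  refine le_bot_iff.1 (le_of_forall_inf_le (le_top.trans hfin.ge) fun S => ?_)
  refine le_of_forall_inf_le (inf_le_left.trans (havoid_fin S)) fun N => ?_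
  rw [← inf_compl_eq_bot (a := ⨆ z ∈ S, (B z).val (s N))]
  exact le_inf (inf_le_left.trans (inf_le_right.trans (iInf_le _ (s N))))
    (inf_le_right.trans (iInf₂_le N le_rfl))

end CondMetric

end Equivalences

end Conditional

theorem mainTheorem4 {A : Type u} [CompleteBooleanAlgebra A] [Nontrivial A]
    (X : Conditional.CondSet.{u, v} A) (d : Conditional.CondMetric X) :
    List.TFAE [d.Compact, d.Complete ∧ d.TotallyBounded, d.SeqCompact] := by
  tfae_have 1 → 3 := fun h => h.seqCompact
  tfae_have 3 → 2 := fun h => ⟨h.complete, h.totallyBounded⟩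
  tfae_have 2 → 1 := fun h => Conditional.CondMetric.compact_of_complete h.1 h.2
  tfae_finish
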